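/- Theorem (Simply-laced root systems are classified by small graphs). All graphs are finite, without loops or multiple edges. A graph is called small if the spectral radius of its adjacency matrix is less than $2$. For a graph $X$ with vertex set $X_0$, let $(\cdot|\cdot)$ be the symmetric bilinear form on the free abelian group $\mathbb Z^{X_0}$ with $(x|x)=2$ for $x\in X_0$, and, for $x\ne y$ in $X_0$, $(x|y)=-1$ if $xy$ is an edge and $(x|y)=0$ otherwise; let $q_X(v)=(v|v)/2$ be the associated integral quadratic form. A simply-laced root system is a finite, reduced, crystallographic root system in a real vector space (possibly reducible, possibly empty) such that the Cartan integer of any two non-proportional roots is $0$, $1$ or $-1$. (1) A graph is small if and only if it is a disjoint union of ADE graphs, that is, each of its connected components is isomorphic to one of $A_n$ ($n\ge 1$), $D_n$ ($n\ge 4$), $E_6$, $E_7$, $E_8$. (2) A graph $X$ is small if and only if $q_X$ is positive definite on $\mathbb Z^{X_0}$. (3) If $X$ is small, then the set of norm-$1$ vectors $\Gamma_X=\{v\in\mathbb Z^{X_0} : q_X(v)=1\}$ is a simply-laced root system in $\mathbb R^{X_0}$, where the coroot of $v\in\Gamma_X$ is the linear functional $(\cdot|v)$, so that the reflection in $v$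 is $w\mapsto w-(w|v)v$. (4) The map $X\mapsto\Gamma_X$ induces a bijection from isomorphism classes of small graphs to isomorphism classes of simply-laced root systems: two small graphs $X$ and $X'$ are isomorphic if and only if the root systems $\Gamma_X$ and $\Gamma_{X'}$ are isomorphic, and every simply-laced root system is isomorphic to $\Gamma_X$ for some small graph $X$. -/

import Mathlib

universe u v w

noncomputable section

namespace SmallGraph

open Classical in
/-- A finite graph is small when the spectral radius of its adjacency matrix is less than `2`.
(The adjacency matrix is real symmetric, so all of its eigenvalues are real.) -/
def IsSmall {V : Type*} [Fintype V] (X : SimpleGraph V) : Prop :=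
  spectralRadius ℝ (X.adjMatrix ℝ) < 2

/-! ### The graphs of type `A`, `D`, `E` -/

/-- The graph on `Fin n` (`n` vertices) consisting of the path `0 - 1 - ⋯ - (n - 2)`
together with one further vertex `n - 1` joined to the vertex `k` of the path. -/
def forkGraph (n k : ℕ) : SimpleGraph (Fin n) :=
  SimpleGraph.fromRel fun i j =>
    ((i : ℕ) + 1 = j ∧ (j : ℕ) + 1 < n) ∨ ((i : ℕ) = k ∧ (j : ℕ) + 1 = n)

/-- `A_n`: the path with `n` vertices. -/
def graphA (n : ℕ) : SimpleGraph (Fin n) := SimpleGraph.pathGraph n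

/-- `D_n` (for `4 ≤ n`): legs of lengths `n - 3`, `1`, `1` at the branch vertex `n - 3`. -/
def graphD (n : ℕ) : SimpleGraph (Fin n) := forkGraph n (n - 3)

/-- `E_n` (for `n = 6, 7, 8`): legs of lengths `2`, `n - 4`, `1` at the branch vertex `2`. -/
def graphE (n : ℕ) : SimpleGraph (Fin n) := forkGraph n 2

/-- The graph `X` is isomorphic to `A_n` (`1 ≤ n`), `D_n` (`4 ≤ n`), `E_6`, `E_7` or `E_8`. -/
def IsADE {V : Type*} (X : SimpleGraph V) : Prop :=
  (∃ n, 1 ≤ n ∧ Nonempty (X ≃g graphA n)) ∨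
  (∃ n, 4 ≤ n ∧ Nonempty (X ≃g graphD n)) ∨
  (∃ n, 6 ≤ n ∧ n ≤ 8 ∧ Nonempty (X ≃g graphE n))

/-- The graph `X` is a disjoint union of ADE graphs: each of its connected components is one. -/
def IsDisjointUnionOfADE {V : Type*} (X : SimpleGraph V) : Prop :=
  ∀ C : X.ConnectedComponent, IsADE C.toSimpleGraph

/-! ### The quadratic form of a graph -/

section Form

variable {V : Type*} (X : SimpleGraph V)

open Classical in
/-- The numbers `(x|y)` for vertices `x`, `y`. -/
def gram : Matrix V V ℤ :=
  fun x y => if x = y then 2 else if X.Adj x y then -1 else 0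

theorem gram_symm (x y : V) : gram X x y = gram X y x := by
  by_cases h : x = y
  · rw [h]
  · by_cases ha : X.Adj x y
    · simp [gram, h, Ne.symm h, ha, ha.symm]
    · simp [gram, h, Ne.symm h, ha, mt X.adj_symm ha]

variable [Fintype V]

open Classical in
/-- The symmetric bilinear form `(v|w)` on `ℤ X₀ = (V → ℤ)`. -/
def form : LinearMap.BilinForm ℤ (V → ℤ) := Matrix.toBilin' (gram X)

open Classical in
/-- The real bilinear form on `ℝ X₀ = (V → ℝ)` that extends `form X`. -/
def realForm : LinearMap.BilinForm ℝ (V → ℝ) :=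
  Matrix.toBilin' ((gram X).map (fun z : ℤ => (z : ℝ)))

theorem form_apply (v w : V → ℤ) : form X v w = ∑ x, ∑ y, v x * gram X x y * w y := by
  classical
  simp only [form, Matrix.toBilin'_apply]

theorem realForm_apply (v w : V → ℝ) :
    realForm X v w = ∑ x, ∑ y, v x * (gram X x y : ℝ) * w y := by
  classical
  simp only [realForm, Matrix.toBilin'_apply, Matrix.map_apply]

theorem form_comm (v w : V → ℤ) : form X v w = form X w v := by
  rw [form_apply, form_apply, Finset.sum_comm]
  refine Finset.sum_congr rfl fun x _ => Finset.sum_congr rfl fun y _ => ?_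
  rw [gram_symm X y x]; ring

/-- An integer vector, seen as a real vector. -/
def toReal {V : Type*} (v : V → ℤ) : V → ℝ := fun x => (v x : ℝ)

theorem toReal_injective {V : Type*} : Function.Injective (toReal (V := V)) := by
  intro v w h
  funext x
  exact Int.cast_injective (α := ℝ) (congrFun h x)

theorem realForm_toReal (v w : V → ℤ) :
    realForm X (toReal v) (toReal w) = (form X v w : ℤ) := by
  rw [realForm_apply, form_apply]
  push_cast
  rfl

/-- The bilinear form of a graph is even. -/
theorem even_form (v : V → ℤ) : Even (form X v v) := by
  classical
  rw [even_iff_two_dvd]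
  refine (ZMod.intCast_zmod_eq_zero_iff_dvd _ 2).mp ?_
  rw [form_apply, ← Finset.sum_product']
  push_cast
  refine Finset.sum_involution (fun p _ => (p.2, p.1)) ?_ ?_ (by simp) (by simp)
  · rintro ⟨x, y⟩ -
    simp only
    rw [gram_symm X y x]
    have h : ∀ a b c : ZMod 2, a * b * c + c * b * a = 0 := by decide
    exact h _ _ _
  · rintro ⟨x, y⟩ - h hxy
    apply h
    obtain rfl : y = x := by simpa using congrArg Prod.fst hxy
    have h2 : ((2 : ℤ) : ZMod 2) = 0 := by decide
    have hg : gram X y y = 2 := by simp [gram]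
    simp only [hg, h2, mul_zero, zero_mul]

/-- The integral quadratic form `q_X(v) = (v|v)/2` on `ℤ X₀`. The division is exact. -/
def quadForm : QuadraticForm ℤ (V → ℤ) where
  toFun v := form X v v / 2
  toFun_smul a v := by
    obtain ⟨k, hk⟩ := even_iff_two_dvd.mp (even_form X v)
    have : form X (a • v) (a • v) = 2 * (a * a * k) := by
      simp only [map_smul, LinearMap.smul_apply, smul_eq_mul, hk]; ring
    rw [this, hk]
    simp
  exists_companion' := ⟨form X, fun v w => by
    obtain ⟨k, hk⟩ := even_iff_two_dvd.mp (even_form X v)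
    obtain ⟨l, hl⟩ := even_iff_two_dvd.mp (even_form X w)
    have : form X (v + w) (v + w) = 2 * (k + l + form X v w) := by
      simp only [map_add, LinearMap.add_apply, hk, hl, form_comm X w v]; ring
    rw [this, hk, hl]
    simp⟩

theorem two_mul_quadForm (v : V → ℤ) : 2 * quadForm X v = form X v v :=
  Int.mul_ediv_cancel' (even_iff_two_dvd.mp (even_form X v))

/-- The quadratic form of a small graph is positive definite. -/
theorem IsSmall.posDef {X : SimpleGraph V} (h : IsSmall X) : (quadForm X).PosDef := by
  classical
  set M : Matrix V V ℝ := (gram X).map (fun z : ℤ => (z : ℝ)) with hM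
  have hMA : X.adjMatrix ℝ = algebraMap ℝ (Matrix V V ℝ) 2 - M := by
    ext x y
    by_cases hxy : x = y
    · subst hxy; simp [hM, gram, Matrix.algebraMap_matrix_apply]
    · by_cases ha : X.Adj x y <;>
        simp [hM, gram, hxy, ha, Matrix.algebraMap_matrix_apply, SimpleGraph.adjMatrix_apply]
  have hH : M.IsHermitian := by
    ext x y
    simp [hM, gram_symm X y x]
  have hP : M.PosDef := by
    rw [hH.posDef_iff_eigenvalues_pos]
    intro i
    have hi : 2 - hH.eigenvalues i ∈ spectrum ℝ (X.adjMatrix ℝ) := by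
      rw [hMA, ← spectrum.singleton_sub_eq]
      exact Set.sub_mem_sub rfl (hH.eigenvalues_mem_spectrum_real i)
    have hlt : ((‖2 - hH.eigenvalues i‖₊ : NNReal) : ENNReal) < 2 := by
      unfold IsSmall spectralRadius at h
      refine lt_of_le_of_lt ?_ (by convert h)
      exact le_iSup₂ (f := fun (k : ℝ) (_ : k ∈ spectrum ℝ (X.adjMatrix ℝ)) =>
        ((‖k‖₊ : NNReal) : ENNReal)) _ hi
    have h2 : ‖2 - hH.eigenvalues i‖ < 2 := by exact_mod_cast hlt
    have := (abs_lt.mp (by simpa using h2)).2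
    linarith
  intro v hv
  have hv' : toReal v ≠ 0 := fun h0 => hv (toReal_injective (h0.trans (by ext; simp [toReal])))
  have h1 : 0 < realForm X (toReal v) (toReal v) := by
    have := hP.dotProduct_mulVec_pos hv'
    rw [realForm, Matrix.toBilin'_apply']
    simpa using this
  rw [realForm_toReal] at h1
  have h2 : 0 < form X v v := by exact_mod_cast h1
  have := two_mul_quadForm X v
  lia

end Form

/-! ### The root system of a small graph -/

section Roots

variable {V : Type*} [Fintype V]

/-- The set of roots: the vectors of norm `1` in the lattice `(ℤ X₀, q_X)`. -/
def roots (X : SimpleGraph V) : Set (V → ℤ) := {v | quadForm X v = 1}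

theorem form_self_of_mem {X : SimpleGraph V} (v : roots X) : form X v v = 2 := by
  rw [← two_mul_quadForm, show quadForm X (v : V → ℤ) = 1 from v.2]; rfl

/-- The reflection `w ↦ w - (w|v) v` in a root `v` preserves the set of roots. -/
theorem reflection_mem {X : SimpleGraph V} (v w : roots X) :
    (w : V → ℤ) - form X w v • (v : V → ℤ) ∈ roots X := by
  have h := two_mul_quadForm X ((w : V → ℤ) - form X w v • (v : V → ℤ))
  simp only [map_sub, LinearMap.sub_apply, map_smul, LinearMap.smul_apply, smul_eq_mul,
    form_self_of_mem, form_comm X (v : V → ℤ) w] at h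
  change quadForm X _ = 1
  linarith

theorem reflection_reflection {X : SimpleGraph V} (v w : roots X) :
    ((w : V → ℤ) - form X w v • (v : V → ℤ)) -
      form X ((w : V → ℤ) - form X w v • (v : V → ℤ)) v • (v : V → ℤ) = w := by
  simp only [map_sub, LinearMap.sub_apply, map_smul, LinearMap.smul_apply, smul_eq_mul,
    form_self_of_mem, sub_smul, mul_smul]
  module

/-- The root system of a small graph `X`: it lives in the real vector space `ℝ X₀ = (V → ℝ)`, its
roots are the norm `1` vectors of the lattice `ℤ X₀`, and the coroot of a root `v` is the linear
functional `(v|·)`, so that the reflection in `v` is `w ↦ w - (w|v) v`. -/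
def rootSystem (X : SimpleGraph V) (hX : IsSmall X) :
    RootPairing (roots X) ℝ (V → ℝ) (Module.Dual ℝ (V → ℝ)) where
  toLinearMap := Module.Dual.eval ℝ (V → ℝ)
  root := ⟨fun v => toReal v, fun _ _ h => Subtype.ext (toReal_injective h)⟩
  coroot := ⟨fun v => realForm X (toReal v), fun v w h => by
    have hz : ∀ u : V → ℤ, form X ((v : V → ℤ) - w) u = 0 := fun u => by
      have := congrArg (fun f => f (toReal u)) h
      simp only [realForm_toReal] at this
      have h' : form X (v : V → ℤ) u = form X (w : V → ℤ) u := by exact_mod_cast this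
      simp [h']
    by_contra hne
    have hpos := hX.posDef ((v : V → ℤ) - w) fun h0 => hne (Subtype.ext (sub_eq_zero.mp h0))
    have := two_mul_quadForm X ((v : V → ℤ) - w)
    rw [hz] at this
    lia⟩
  root_coroot_two v := by
    change realForm X (toReal v) (toReal v) = 2
    rw [realForm_toReal, form_self_of_mem]; norm_num
  reflectionPerm v := Function.Involutive.toPerm
    (fun w => ⟨(w : V → ℤ) - form X w v • (v : V → ℤ), reflection_mem v w⟩)
    (fun w => Subtype.ext (reflection_reflection v w))
  reflectionPerm_root v w := by
    change toReal w - realForm X (toReal v) (toReal w) • toReal v =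
      toReal ((w : V → ℤ) - form X w v • (v : V → ℤ))
    rw [realForm_toReal, form_comm]
    ext x
    simp [toReal]
  reflectionPerm_coroot v w := by
    change realForm X (toReal w) - realForm X (toReal w) (toReal v) • realForm X (toReal v) =
      realForm X (toReal ((w : V → ℤ) - form X w v • (v : V → ℤ)))
    have : toReal ((w : V → ℤ) - form X w v • (v : V → ℤ)) =
        toReal w - (form X w v : ℝ) • toReal (v : V → ℤ) := by
      ext x
      simp [toReal]
    rw [this, realForm_toReal, map_sub, map_smul]

end Roots

/-- A root pairing over `ℝ` is a simply-laced root system if it is a finite, reduced,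
crystallographic root system in which the Cartan integer of any two non-proportional roots is
`0`, `1` or `-1`. -/
structure IsSimplyLacedRootSystem {ι M N : Type*} [AddCommGroup M] [Module ℝ M]
    [AddCommGroup N] [Module ℝ N] (P : RootPairing ι ℝ M N) : Prop where
  finite : Finite ι
  isRootSystem : P.IsRootSystem
  isCrystallographic : P.IsCrystallographic
  isReduced : P.IsReduced
  pairing_mem : ∀ i j, P.root i ≠ P.root j → P.root i ≠ -P.root j →
    P.pairing i j = 0 ∨ P.pairing i j = 1 ∨ P.pairing i j = -1

end SmallGraph

end

noncomputable section

namespace SmallGraph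

/-! ### Entries of the Gram matrix -/

section Basic

variable {V : Type*} (X : SimpleGraph V)

/-! Smallness, positive definiteness and the ADE condition are linked in a cycle. The Gram matrix is
`2 - A` with `A` the adjacency matrix, so small graphs are positive definite (`IsSmall.posDef`). A
connected positive definite graph is a tree (`isTree_of_posDef`). Removing a leaf and restoring it,
by induction, shows that it is a path or a fork (`isPathOrFork_of_posDef`): any other position of
the leaf creates an extended diagram of type `D` or `E₆`, which supports a nonzero nonnegative
vector of norm at most `0`. The extended diagrams of types `E₇` and `E₈` then bound the legs of a
fork (`isADE_of_posDef`). Finally, an ADE graph carries a positive weight `u` with `A u < 2 u` at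
every vertex, and this bounds all eigenvalues (`HasSubharmonicWeight.isSmall`).

For the root systems, `v - w` and `v + w` have positive norm when `v ≠ ±w` are roots, so `(v|w)` is
`0`, `1` or `-1`. The coordinates of a root all have one sign (`nonneg_or_nonpos_of_mem_roots`), so
the vertices form a base whose Cartan matrix is the Gram matrix of the graph. An isomorphism of root
systems can be adjusted by reflections to match two given bases (`exists_equiv_map_support`), and it
then restricts to a graph isomorphism; conversely, the Cartan matrix determines the root system
(`nonempty_equiv_of_pairing_eq`). In an arbitrary simply-laced root system, joining the
non-orthogonal simple roots gives a graph whose Gram matrix is the Cartan matrix, and it is small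
because the canonical invariant form is positive definite. -/

@[simp]
theorem gram_self (x : V) : gram X x x = 2 := by simp [gram]

theorem gram_of_adj {X : SimpleGraph V} {x y : V} (h : X.Adj x y) : gram X x y = -1 := by
  simp [gram, h, h.ne]

theorem gram_of_not_adj {X : SimpleGraph V} {x y : V} (hne : x ≠ y) (h : ¬ X.Adj x y) :
    gram X x y = 0 := by
  simp [gram, h, hne]

theorem gram_nonpos {x y : V} (hne : x ≠ y) : gram X x y ≤ 0 := by
  by_cases h : X.Adj x y
  · simp [gram_of_adj h]
  · simp [gram_of_not_adj hne h]

theorem gram_eq_neg_one_iff {x y : V} : gram X x y = -1 ↔ X.Adj x y := by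
  refine ⟨fun h => ?_, gram_of_adj⟩
  by_contra hn
  rcases eq_or_ne x y with rfl | hne
  · simp at h
  · simp [gram_of_not_adj hne hn] at h

variable [Fintype V]

theorem form_single [DecidableEq V] (x y : V) :
    form X (Pi.single x 1) (Pi.single y 1) = gram X x y := by
  simp [form_apply, Pi.single_apply]

theorem posDef_iff_form_pos : (quadForm X).PosDef ↔ ∀ v, v ≠ 0 → 0 < form X v v := by
  refine forall₂_congr fun v _ => ?_
  have := two_mul_quadForm X v
  lia

/-! ### Positive weights and the spectral radius -/

open Classical in
/-- The graph has a positive weight function whose sum over the neighbours of any vertex is less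
than twice its value at that vertex. -/
def HasSubharmonicWeight {V : Type*} [Fintype V] (X : SimpleGraph V) : Prop :=
  ∃ u : V → ℝ, (∀ x, 0 < u x) ∧ ∀ x, ∑ y, (if X.Adj x y then u y else 0) < 2 * u x

end Basic

/-- Collatz–Wielandt bound: every eigenvalue is bounded in absolute value by the largest ratio `(A
u)(x) / u x`. This maximum `c` is attained at some vertex, so it is still less than `2`. -/
theorem HasSubharmonicWeight.isSmall {V : Type*} [Fintype V] {X : SimpleGraph V}
    (h : HasSubharmonicWeight X) : IsSmall X := by
  classical
  obtain ⟨u, hu, hlt⟩ := h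
  unfold IsSmall spectralRadius
  rcases isEmpty_or_nonempty V with hV | hV
  · simp [spectrum.of_subsingleton]
  obtain ⟨x₀, -, hx₀⟩ := Finset.exists_max_image Finset.univ
    (fun x => (∑ y, (X.adjMatrix ℝ) x y * u y) / u x) Finset.univ_nonempty
  set c : ℝ := (∑ y, (X.adjMatrix ℝ) x₀ y * u y) / u x₀ with hc
  have hA : ∀ x y, 0 ≤ X.adjMatrix ℝ x y := fun x y => by
    rw [SimpleGraph.adjMatrix_apply]; split_ifs <;> norm_num
  have hc0 : 0 ≤ c :=
    div_nonneg (Finset.sum_nonneg fun y _ => mul_nonneg (hA _ _) (hu y).le) (hu _).le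
  have hc2 : c < 2 := by
    rw [hc, div_lt_iff₀ (hu _)]
    simpa [SimpleGraph.adjMatrix_apply, -SimpleGraph.adjMatrix_mulVec_apply] using hlt x₀
  have hle : ∀ x, ∑ y, (X.adjMatrix ℝ) x y * u y ≤ c * u x := fun x =>
    (div_le_iff₀ (hu x)).mp (hx₀ x (Finset.mem_univ x))
  have key : ∀ k ∈ spectrum ℝ (X.adjMatrix ℝ), ‖k‖ ≤ c := by
    intro k hk
    rw [← Matrix.spectrum_toLin', ← Module.End.hasEigenvalue_iff_mem_spectrum] at hk
    obtain ⟨v, hv⟩ := hk.exists_hasEigenvector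
    have hv0 : v ≠ 0 := hv.2
    have hvk : ∀ x, ∑ y, X.adjMatrix ℝ x y * v y = k * v x := fun x => by
      simpa [Matrix.toLin'_apply, Matrix.mulVec, dotProduct] using congrFun hv.apply_eq_smul x
    -- At a vertex maximising `|v x| / u x`, the eigenvector is dominated everywhere by `m * u`,
    -- with equality at `x`; evaluating `A v = k v` there gives `|k| ≤ c`.
    obtain ⟨x, -, hx⟩ := Finset.exists_max_image Finset.univ
      (fun x => |v x| / u x) Finset.univ_nonempty
    set m := |v x| / u x with hm
    have hvm : ∀ y, |v y| ≤ m * u y := fun y =>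
      (div_le_iff₀ (hu y)).mp (hx y (Finset.mem_univ y))
    have hvx : |v x| = m * u x := by rw [hm, div_mul_cancel₀ _ (hu x).ne']
    have hmpos : 0 < m := by
      obtain ⟨y, hy⟩ := Function.ne_iff.mp hv0
      have : 0 < |v y| := abs_pos.mpr hy
      by_contra hn
      have := mul_nonpos_of_nonpos_of_nonneg (not_lt.mp hn) (hu y).le
      linarith [hvm y]
    have h1 : |k| * (m * u x) ≤ c * (m * u x) := by
      calc |k| * (m * u x) = |∑ y, X.adjMatrix ℝ x y * v y| := by rw [hvk, abs_mul, hvx]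
        _ ≤ ∑ y, |X.adjMatrix ℝ x y * v y| := Finset.abs_sum_le_sum_abs _ _
        _ ≤ ∑ y, m * (X.adjMatrix ℝ x y * u y) := by
          refine Finset.sum_le_sum fun y _ => ?_
          rw [abs_mul, abs_of_nonneg (hA x y)]
          nlinarith [mul_le_mul_of_nonneg_left (hvm y) (hA x y)]
        _ = m * ∑ y, X.adjMatrix ℝ x y * u y := by rw [Finset.mul_sum]
        _ ≤ m * (c * u x) := mul_le_mul_of_nonneg_left (hle x) hmpos.le
        _ = c * (m * u x) := by ring
    exact le_of_mul_le_mul_right h1 (mul_pos hmpos (hu x))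
  refine lt_of_le_of_lt (b := ENNReal.ofReal c) (iSup₂_le fun k hk => ?_) ?_
  · have h := ENNReal.ofReal_le_ofReal (key k (by convert hk))
    rwa [ofReal_norm] at h
  · rw [ENNReal.ofReal_lt_iff_lt_toReal hc0 (by simp)]; simpa

theorem HasSubharmonicWeight.of_iso {V W : Type*} [Fintype V] [Fintype W] {X : SimpleGraph V}
    {Y : SimpleGraph W} (e : X ≃g Y) (h : HasSubharmonicWeight Y) : HasSubharmonicWeight X := by
  classical
  obtain ⟨u, hu, hlt⟩ := h
  refine ⟨fun x => u (e x), fun x => hu _, fun x => ?_⟩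
  refine lt_of_eq_of_lt ?_ (hlt (e x))
  refine Fintype.sum_equiv e.toEquiv _ _ fun y => ?_
  simp [e.map_adj_iff]

theorem HasSubharmonicWeight.of_components {V : Type*} [Fintype V] {X : SimpleGraph V}
    (h : ∀ C : X.ConnectedComponent, ∀ [Fintype C], HasSubharmonicWeight C.toSimpleGraph) :
    HasSubharmonicWeight X := by
  classical
  choose u hu hlt using fun C : X.ConnectedComponent => h C
  -- Neighbours lie in the same component, but their weights are indexed by components that are
  -- equal only propositionally.
  have hw : ∀ (C : X.ConnectedComponent) (y : C),
      u (X.connectedComponentMk y) ⟨y, rfl⟩ = u C y := by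
    rintro _ ⟨y, rfl⟩
    rfl
  refine ⟨fun x => u (X.connectedComponentMk x) ⟨x, rfl⟩, fun x => hu _ _, fun x => ?_⟩
  refine lt_of_eq_of_lt (Eq.symm ?_) (hlt (X.connectedComponentMk x) ⟨x, rfl⟩)
  refine Fintype.sum_of_injective Subtype.val Subtype.val_injective _ _ (fun y hy => ?_) fun y => ?_
  · refine if_neg fun h => hy ⟨⟨y, ?_⟩, rfl⟩
    exact SimpleGraph.ConnectedComponent.sound h.symm.reachable
  · exact congrArg (fun r => if X.Adj x y then r else 0) (hw _ y).symm

/-! ### Explicit weights for the ADE graphs -/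

theorem sum_adj_le {n : ℕ} {X : SimpleGraph (Fin n)} [DecidableRel X.Adj] (U : ℕ → ℝ) (x : Fin n)
    (S : Finset ℕ) (hU : ∀ m ∈ S, 0 ≤ U m) (hS : ∀ y, X.Adj x y → (y : ℕ) ∈ S) :
    ∑ y, (if X.Adj x y then U y else 0) ≤ ∑ m ∈ S, U m := by
  rw [← Finset.sum_filter, ← Finset.sum_image (f := U) (g := fun y : Fin n => (y : ℕ))
    (by intro a _ b _ h; exact Fin.ext h)]
  refine Finset.sum_le_sum_of_subset_of_nonneg ?_ fun m hm _ => hU m hm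
  intro m hm
  simp only [Finset.mem_image, Finset.mem_filter, Finset.mem_univ, true_and] at hm
  obtain ⟨y, hy, rfl⟩ := hm
  exact hS y hy

theorem forkGraph_adj {n k : ℕ} {i j : Fin n} : (forkGraph n k).Adj i j ↔ i ≠ j ∧
    (((i : ℕ) + 1 = j ∧ (j : ℕ) + 1 < n) ∨ ((i : ℕ) = k ∧ (j : ℕ) + 1 = n) ∨
      ((j : ℕ) + 1 = i ∧ (i : ℕ) + 1 < n) ∨ ((j : ℕ) = k ∧ (i : ℕ) + 1 = n)) := by
  simp [forkGraph, SimpleGraph.fromRel_adj, or_assoc]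

/-- Here, as for `D` and `E`, the weights are the coefficients of the sum of the positive roots.
That vector pairs to `2` with every simple root, so the sum over the neighbours is exactly `2` less
than twice the value. -/
theorem hasSubharmonicWeight_graphA (n : ℕ) : HasSubharmonicWeight (graphA n) := by
  classical
  have hpos : ∀ x : Fin n, 0 < ((x : ℕ) + 1 : ℝ) * (n - (x : ℕ)) := fun x => by
    have : ((x : ℕ) : ℝ) < n := by exact_mod_cast x.2
    exact mul_pos (by positivity) (by linarith)
  let U : ℕ → ℝ := fun m => (m + 1 : ℝ) * (n - m)
  have hU : ∀ m ≤ n, 0 ≤ U m := fun m hm => by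
    have : (m : ℝ) ≤ n := by exact_mod_cast hm
    exact mul_nonneg (by positivity) (by linarith)
  refine ⟨fun x => U x, hpos, fun x => ?_⟩
  have hx := x.2
  rcases Nat.eq_zero_or_pos (x : ℕ) with h0 | h0
  · refine (sum_adj_le U x {1} ?_ ?_).trans_lt ?_
    · simpa using hU 1 (by lia)
    · intro y hy
      have := SimpleGraph.pathGraph_adj.mp hy
      simp; lia
    · simp [U, h0]; linarith
  · obtain ⟨m, hm⟩ : ∃ m, (x : ℕ) = m + 1 := ⟨x - 1, by lia⟩
    -- At the last vertex `m + 2 = n` is not a neighbour, but `U n = 0`.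
    refine (sum_adj_le U x {m, m + 2} ?_ ?_).trans_lt ?_
    · simp only [Finset.mem_insert, Finset.mem_singleton]
      rintro _ (rfl | rfl) <;> exact hU _ (by lia)
    · intro y hy
      have := SimpleGraph.pathGraph_adj.mp hy
      simp; lia
    · rw [Finset.sum_pair (by lia)]
      simp only [U, hm]
      push_cast
      linarith

theorem hasSubharmonicWeight_graphD (n : ℕ) (hn : 4 ≤ n) : HasSubharmonicWeight (graphD n) := by
  classical
  obtain ⟨n, rfl⟩ := Nat.exists_eq_add_of_le hn
  -- The two end vertices at the branch vertex `n + 1` share equally the value that the quadratic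
  -- formula would take at `n + 2`.
  let U : ℕ → ℝ := fun m => if m < n + 2 then (m + 1 : ℝ) * (2 * n + 6 - m)
    else (n + 3 : ℝ) * (n + 4) / 2
  have hU : ∀ m, 0 < U m := fun m => by
    by_cases hm : m < n + 2
    · have : (m : ℝ) < n + 2 := by exact_mod_cast hm
      simp only [U, hm, if_true]
      exact mul_pos (by positivity) (by linarith)
    · simp only [U, hm, if_false]
      positivity
  refine ⟨fun x => U x, fun x => hU x, fun x => ?_⟩
  have key : ∀ S : Finset ℕ, (∀ y, (graphD (4 + n)).Adj x y → (y : ℕ) ∈ S) →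
      ∑ m ∈ S, U m < 2 * U x → ∑ y, (if (graphD (4 + n)).Adj x y then U y else 0) < 2 * U x :=
    fun S hS h => (sum_adj_le U x S (fun m _ => (hU m).le) hS).trans_lt h
  have hx := x.2
  have hadj : ∀ y, (graphD (4 + n)).Adj x y → _ := fun y h => (forkGraph_adj.mp h).2
  obtain h | h | h | h : (x : ℕ) = 0 ∨ (∃ m, (x : ℕ) = m + 1 ∧ m < n) ∨ (x : ℕ) = n + 1 ∨
      n + 2 ≤ (x : ℕ) := by
    rcases Nat.eq_zero_or_pos (x : ℕ) with h | h
    · exact Or.inl h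
    · refine Or.inr ?_
      by_cases h' : (x : ℕ) < n + 1
      · exact Or.inl ⟨x - 1, by lia, by lia⟩
      · lia
  · refine key {1} (fun y hy => ?_) ?_
    · have := hadj y hy
      simp; lia
    · simp [U, h]; linarith
  · obtain ⟨m, hm, hmn⟩ := h
    refine key {m, m + 2} (fun y hy => ?_) ?_
    · have := hadj y hy
      simp; lia
    · rw [Finset.sum_pair (by lia)]
      simp only [U, hm, show m < n + 2 by lia, show m + 1 < n + 2 by lia,
        show m + 2 < n + 2 by lia, if_true]
      push_cast
      linarith
  · refine key {n, n + 2, n + 3} (fun y hy => ?_) ?_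
    · have := hadj y hy
      simp; lia
    · rw [Finset.sum_insert (by simp), Finset.sum_pair (by lia)]
      simp [U, h]
      linarith
  · refine key {n + 1} (fun y hy => ?_) ?_
    · have := hadj y hy
      simp; lia
    · simp [U, h.not_gt]
      linarith

theorem hasSubharmonicWeight_graphE (n : ℕ) (hn : 6 ≤ n) (hn' : n ≤ 8) :
    HasSubharmonicWeight (graphE n) := by
  classical
  have key : ∀ u : Fin n → ℤ, (∀ x, 0 < u x) → (∀ x : Fin n, ∑ y : Fin n, (if x ≠ y ∧
    (((x : ℕ) + 1 = y ∧ (y : ℕ) + 1 < n) ∨ ((x : ℕ) = 2 ∧ (y : ℕ) + 1 = n) ∨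
      ((y : ℕ) + 1 = x ∧ (x : ℕ) + 1 < n) ∨ ((y : ℕ) = 2 ∧ (x : ℕ) + 1 = n)) then u y else 0)
        < 2 * u x) → HasSubharmonicWeight (graphE n) := by
    refine fun u hu h => ⟨fun x => u x, fun x => Int.cast_pos.mpr (hu x), fun x => ?_⟩
    simp only [graphE, forkGraph_adj]
    exact_mod_cast h x
  interval_cases n
  · exact key ![16, 30, 42, 30, 16, 22] (by decide) (by decide)
  · exact key ![34, 66, 96, 75, 52, 27, 49] (by decide) (by decide)
  · exact key ![92, 182, 270, 220, 168, 114, 58, 136] (by decide) (by decide)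

theorem IsADE.hasSubharmonicWeight {V : Type*} [Fintype V] {X : SimpleGraph V} (h : IsADE X) :
    HasSubharmonicWeight X := by
  obtain ⟨n, -, ⟨e⟩⟩ | ⟨n, hn, ⟨e⟩⟩ | ⟨n, hn, hn', ⟨e⟩⟩ := h
  · exact (hasSubharmonicWeight_graphA n).of_iso e
  · exact (hasSubharmonicWeight_graphD n hn).of_iso e
  · exact (hasSubharmonicWeight_graphE n hn hn').of_iso e

theorem IsDisjointUnionOfADE.isSmall {V : Type*} [Fintype V] {X : SimpleGraph V}
    (h : IsDisjointUnionOfADE X) : IsSmall X :=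
  (HasSubharmonicWeight.of_components fun C => (h C).hasSubharmonicWeight).isSmall

/-! ### Obstructions to positive definiteness -/

section Lattice

variable {V : Type*}

open Classical in
/-- The standard basis vector of `ℤ X₀` attached to a vertex. -/
def basisVec (x : V) : V → ℤ := Pi.single x 1

@[simp]
theorem basisVec_same (x : V) : basisVec x x = 1 := by simp [basisVec]

theorem basisVec_ne {x y : V} (h : y ≠ x) : basisVec x y = 0 := by simp [basisVec, h]

variable [Fintype V] {X : SimpleGraph V}

@[simp]
theorem form_basisVec (x y : V) : form X (basisVec x) (basisVec y) = gram X x y := by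
  classical
  simpa [basisVec] using form_single X x y

theorem form_sum_basisVec_basisVec_le {T : Finset V} {c t : V} (hc : c ∉ T) (ht : t ∈ T)
    (h : X.Adj c t) : form X (∑ x ∈ T, basisVec x) (basisVec c) ≤ -1 := by
  classical
  simp only [map_sum, LinearMap.sum_apply, form_basisVec]
  rw [← Finset.add_sum_erase _ _ ht, gram_of_adj h.symm]
  have : ∑ x ∈ T.erase t, gram X x c ≤ 0 := Finset.sum_nonpos fun x hx =>
    gram_nonpos X fun hxc => hc (hxc ▸ Finset.mem_of_mem_erase hx)
  linarith

/-- The indicator vector of the vertex set of a path has norm at most `1`. -/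
theorem form_sum_path_le [DecidableEq V] {F : ℕ → V} {a b : ℕ} (hab : a ≤ b)
    (hinj : Set.InjOn F (Set.Icc a b))
    (hadj : ∀ i, a ≤ i → i < b → X.Adj (F i) (F (i + 1))) :
    form X (∑ x ∈ (Finset.Icc a b).image F, basisVec x)
      (∑ x ∈ (Finset.Icc a b).image F, basisVec x) ≤ 2 := by
  induction b, hab using Nat.le_induction with
  | base => simp
  | succ b hb ih =>
    have ih := ih (hinj.mono (Set.Icc_subset_Icc_right b.le_succ))
      fun i hi hib => hadj i hi (hib.trans b.lt_succ_self)
    have hnot : F (b + 1) ∉ (Finset.Icc a b).image F := by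
      simp only [Finset.mem_image, Finset.mem_Icc, not_exists, not_and]
      intro i hi h
      have := hinj ⟨hi.1, by lia⟩ ⟨by lia, le_rfl⟩ h
      lia
    rw [← Finset.insert_Icc_right_eq_Icc_add_one (by lia), Finset.image_insert,
      Finset.sum_insert hnot]
    have h1 := form_sum_basisVec_basisVec_le (X := X) hnot
      (Finset.mem_image_of_mem F (Finset.mem_Icc.mpr ⟨hb, le_rfl⟩)) (hadj b hb b.lt_succ_self).symm
    simp only [map_add, LinearMap.add_apply, form_basisVec, gram_self]
    rw [form_comm X (basisVec (F (b + 1)))]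
    linarith

theorem form_sum_smul {κ : Type*} [Fintype κ] (a b : κ → ℤ) (v w : κ → V → ℤ) :
    form X (∑ i, a i • v i) (∑ j, b j • w j) = ∑ i, ∑ j, a i * b j * form X (v i) (w j) := by
  simp only [map_sum, LinearMap.sum_apply, map_smul, LinearMap.smul_apply, smul_eq_mul,
    Finset.mul_sum]
  rw [Finset.sum_comm]
  exact Finset.sum_congr rfl fun _ _ => Finset.sum_congr rfl fun _ _ => by ring

/-- Since the weights are nonnegative, upper bounds on the inner products suffice. Unforeseen extra
edges only lower the norm, so forbidden configurations need not be induced subgraphs. -/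
theorem not_posDef_of_certificate {m : ℕ} (v : Fin m → V → ℤ) (G : Fin m → Fin m → ℤ)
    (w : Fin m → ℤ) (hw : ∀ i, 0 ≤ w i) (hG : ∀ i j, form X (v i) (v j) ≤ G i j)
    (hle : ∑ i, ∑ j, w i * w j * G i j ≤ 0) (hne : ∑ i, w i • v i ≠ 0) :
    ¬ (quadForm X).PosDef := by
  intro h
  have h1 := (posDef_iff_form_pos X).mp h _ hne
  have h2 : form X (∑ i, w i • v i) (∑ i, w i • v i) ≤ ∑ i, ∑ j, w i * w j * G i j := by
    rw [form_sum_smul]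
    exact Finset.sum_le_sum fun i _ => Finset.sum_le_sum fun j _ =>
      mul_le_mul_of_nonneg_left (hG i j) (mul_nonneg (hw i) (hw j))
  linarith

theorem not_posDef_of_subgraph {m : ℕ} (f : Fin m → V) (hf : Function.Injective f)
    (r : Fin m → Fin m → Prop) [DecidableRel r] (hr : ∀ i j, r i j → X.Adj (f i) (f j))
    (w : Fin m → ℤ) (hw : ∀ i, 0 < w i) (hm : 0 < m)
    (hle : ∑ i, ∑ j, w i * w j * (if i = j then 2 else if r i j then -1 else 0) ≤ 0) :
    ¬ (quadForm X).PosDef := by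
  refine not_posDef_of_certificate (fun i => basisVec (f i)) _ w (fun i => (hw i).le)
    (fun i j => ?_) hle fun h => ?_
  · rw [form_basisVec]
    split_ifs with hij hij'
    · simp [hij]
    · rw [gram_of_adj (hr i j hij')]
    · exact gram_nonpos X (hf.ne hij)
  · have h0 := congrFun h (f ⟨0, hm⟩)
    rw [Finset.sum_apply, Finset.sum_eq_single ⟨0, hm⟩] at h0
    · have := hw ⟨0, hm⟩
      simp at h0
      lia
    · intro j _ hj
      simp [basisVec_ne (hf.ne hj.symm)]
    · simp

/-- Treats all extended diagrams of type `D` at once: the sum over `T` plays the part of a single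
vertex with four neighbours, and the weights `2, 1, 1, 1, 1` give norm at most `8 + 8 - 16 = 0`. -/
theorem not_posDef_of_four_neighbours {T : Finset V}
    (hT : form X (∑ x ∈ T, basisVec x) (∑ x ∈ T, basisVec x) ≤ 2) (c : Fin 4 → V)
    (hc : Function.Injective c) (hcT : ∀ i, c i ∉ T) (hadj : ∀ i, ∃ t ∈ T, X.Adj (c i) t) :
    ¬ (quadForm X).PosDef := by
  have h1 : ∀ i, form X (∑ x ∈ T, basisVec x) (basisVec (c i)) ≤ -1 := fun i => by
    obtain ⟨t, ht, h⟩ := hadj i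
    exact form_sum_basisVec_basisVec_le (hcT i) ht h
  refine not_posDef_of_certificate
    (Fin.cons (∑ x ∈ T, basisVec x) fun i => basisVec (c i))
    (Fin.cons (Fin.cons 2 fun _ => -1) fun i => Fin.cons (-1) fun j => if i = j then 2 else 0)
    ![2, 1, 1, 1, 1] (by decide) ?_ (by decide) ?_
  · intro i j
    refine Fin.cases ?_ (fun i => ?_) i <;> refine Fin.cases ?_ (fun j => ?_) j
    · simpa using hT
    · simpa using h1 j
    · simpa [form_comm X (basisVec (c i))] using h1 i
    · simp only [Fin.cons_succ, form_basisVec]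
      split_ifs with h
      · simp [h]
      · exact gram_nonpos X (hc.ne h)
  · intro h
    have h0 := congrFun h (c 0)
    have h2 : ∀ i, i ≠ 0 → basisVec (c i) (c 0) = 0 := fun i hi => basisVec_ne (hc.ne hi.symm)
    have h3 : (∑ x ∈ T, basisVec x) (c 0) = 0 := by
      rw [Finset.sum_apply]
      exact Finset.sum_eq_zero fun x hx => basisVec_ne fun hxc => hcT 0 (hxc ▸ hx)
    simp [Fin.sum_univ_succ, -Finset.sum_apply, h3] at h0
    linarith [h2 1 (by decide), h2 2 (by decide), h2 3 (by decide)]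

theorem form_sum_comp {W : Type*} [Fintype W] {Y : SimpleGraph W} (f : W ↪ V)
    (hf : ∀ a b, X.Adj (f a) (f b) ↔ Y.Adj a b) (v w : W → ℤ) :
    form X (∑ a, v a • basisVec (f a)) (∑ a, w a • basisVec (f a)) = form Y v w := by
  have hg : ∀ a b, gram X (f a) (f b) = gram Y a b := fun a b => by
    rcases eq_or_ne a b with rfl | hab
    · simp
    · by_cases h : Y.Adj a b
      · rw [gram_of_adj h, gram_of_adj ((hf a b).mpr h)]
      · rw [gram_of_not_adj hab h, gram_of_not_adj (f.injective.ne hab) (mt (hf a b).mp h)]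
  rw [form_apply Y, form_sum_smul]
  simp only [form_basisVec, hg]
  exact Finset.sum_congr rfl fun _ _ => Finset.sum_congr rfl fun _ _ => by ring

theorem posDef_induce (h : (quadForm X).PosDef) (s : Set V) [Fintype s] :
    (quadForm (X.induce s)).PosDef := by
  rw [posDef_iff_form_pos] at h ⊢
  intro v hv
  rw [← form_sum_comp (X := X) (Function.Embedding.subtype _) (by simp)]
  refine h _ fun h0 => hv ?_
  ext a
  have := congrFun h0 a
  rw [Finset.sum_apply, Finset.sum_eq_single a] at this
  · simpa using this
  · intro b _ hb
    have : (a : V) ≠ b := fun h => hb (Subtype.ext h.symm)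
    simp [basisVec_ne this]
  · simp

/-- The all-ones vector has norm `2 (|V| - |E|)`, so positivity forces fewer edges than vertices. -/
theorem isTree_of_posDef (h : (quadForm X).PosDef) (hc : X.Connected) : X.IsTree := by
  classical
  have := hc.nonempty
  have h1 := (posDef_iff_form_pos X).mp h 1 one_ne_zero
  have h2 : form X 1 1 = ∑ x, (2 - (X.degree x : ℤ)) := by
    rw [form_apply]
    refine Finset.sum_congr rfl fun x _ => ?_
    rw [← Finset.add_sum_erase _ _ (Finset.mem_univ x)]
    have : ∑ y ∈ Finset.univ.erase x, (1 : V → ℤ) x * gram X x y * (1 : V → ℤ) y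
        = ∑ y ∈ Finset.univ.erase x, if X.Adj x y then -1 else 0 := by
      refine Finset.sum_congr rfl fun y hy => ?_
      have := (Finset.ne_of_mem_erase hy).symm
      simp [gram, this]
    rw [this, Finset.sum_erase _ (by simp), ← Finset.sum_filter]
    simp [← SimpleGraph.card_neighborFinset_eq_degree, SimpleGraph.neighborFinset_eq_filter]
    rfl
  rw [h2, Finset.sum_sub_distrib, ← Nat.cast_sum, X.sum_degrees_eq_twice_card_edges] at h1
  have h3 := hc.card_vert_le_card_edgeSet_add_one
  rw [SimpleGraph.isTree_iff_connected_and_card]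
  refine ⟨hc, ?_⟩
  simp only [Nat.card_eq_fintype_card, ← SimpleGraph.edgeFinset_card] at h3 ⊢
  simp at h1
  lia

end Lattice

/-! ### Connected positive definite graphs are ADE -/

section Labels

variable {V : Type*}

/-- `f` enumerates the vertices of `X` by the numbers below `n` so that adjacency becomes `r`. -/
structure IsLabelling (X : SimpleGraph V) (n : ℕ) (r : ℕ → ℕ → Prop) (f : ℕ → V) : Prop where
  inj : ∀ i < n, ∀ j < n, f i = f j → i = j
  surj : ∀ x, ∃ i < n, f i = x
  adj_iff : ∀ i < n, ∀ j < n, X.Adj (f i) (f j) ↔ r i j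

/-- Adjacency in the path `0 - 1 - 2 - ⋯`. -/
def pathRel (i j : ℕ) : Prop := i + 1 = j ∨ j + 1 = i

/-- Adjacency in `forkGraph n k`, for `k + 1 < n`. -/
def forkRel (n k i j : ℕ) : Prop :=
  (i + 1 = j ∧ j + 1 < n) ∨ (i = k ∧ j + 1 = n) ∨ (j + 1 = i ∧ i + 1 < n) ∨ (j = k ∧ i + 1 = n)

instance (n k : ℕ) : DecidableRel (forkRel n k) := fun i j => by
  unfold forkRel
  infer_instance

variable {X : SimpleGraph V}

theorem IsLabelling.nonempty_iso {n : ℕ} {r : ℕ → ℕ → Prop} {f : ℕ → V}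
    (h : IsLabelling X n r f) (Y : SimpleGraph (Fin n)) (hY : ∀ i j, Y.Adj i j ↔ r i j) :
    Nonempty (X ≃g Y) := by
  have hb : Function.Bijective fun i : Fin n => f i :=
    ⟨fun i j hij => Fin.ext (h.inj i i.2 j j.2 hij), fun x => by
      obtain ⟨i, hi, hx⟩ := h.surj x
      exact ⟨⟨i, hi⟩, hx⟩⟩
  refine ⟨SimpleGraph.Iso.symm ⟨Equiv.ofBijective _ hb, fun {i j} => ?_⟩⟩
  rw [hY]
  exact h.adj_iff i i.2 j j.2

theorem IsLabelling.relabel {n : ℕ} {r r' : ℕ → ℕ → Prop} {f : ℕ → V}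
    (h : IsLabelling X n r f) (σ : ℕ → ℕ) (hσ : ∀ i < n, σ i < n) (hσσ : ∀ i < n, σ (σ i) = i)
    (hr : ∀ i < n, ∀ j < n, r' i j ↔ r (σ i) (σ j)) : IsLabelling X n r' (f ∘ σ) where
  inj i hi j hj hij := by
    have := h.inj _ (hσ i hi) _ (hσ j hj) hij
    rw [← hσσ i hi, this, hσσ j hj]
  surj x := by
    obtain ⟨i, hi, hx⟩ := h.surj x
    exact ⟨σ i, hσ i hi, by simp [hσσ i hi, hx]⟩
  adj_iff i hi j hj := (h.adj_iff _ (hσ i hi) _ (hσ j hj)).trans (hr i hi j hj).symm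

theorem IsLabelling.fork_reverse {n k : ℕ} {f : ℕ → V} (h : IsLabelling X n (forkRel n k) f)
    (hk : k + 2 ≤ n) : ∃ g, IsLabelling X n (forkRel n (n - 2 - k)) g :=
  -- Reverses the path `0, …, n - 2` and fixes the extra vertex `n - 1`.
  ⟨_, h.relabel (fun i => if i + 1 < n then n - 2 - i else i) (by grind) (by grind)
    (by intro i hi j hj; simp only [forkRel]; grind)⟩

/-- `X` is the graph labelled by `F` on the numbers below `n`, with a leaf `v` attached at `j`. -/
structure IsLeafExtension (X : SimpleGraph V) (v : V) (n j : ℕ) (r : ℕ → ℕ → Prop) (F : ℕ → V) :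
    Prop where
  inj : ∀ i < n, ∀ j < n, F i = F j → i = j
  ne : ∀ i < n, F i ≠ v
  surj : ∀ x, x ≠ v → ∃ i < n, F i = x
  adj_iff : ∀ i < n, ∀ j < n, X.Adj (F i) (F j) ↔ r i j
  lt : j < n
  adj_leaf : ∀ i < n, X.Adj (F i) v ↔ i = j

theorem IsLabelling.isLeafExtension {v : V} {n : ℕ} {r : ℕ → ℕ → Prop}
    {f : ℕ → ({v}ᶜ : Set V)} (h : IsLabelling (X.induce {v}ᶜ) n r f) (hv : ∃! y, X.Adj v y) :
    ∃ j, IsLeafExtension X v n j r fun i => f i := by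
  obtain ⟨y, hy, hyu⟩ := hv
  obtain ⟨j, hj, hjy⟩ := h.surj ⟨y, hy.ne'⟩
  refine ⟨j, fun i hi k hk hik => h.inj i hi k hk (Subtype.ext hik), fun i _ => (f i).2,
    fun x hx => ?_, fun i hi k hk => h.adj_iff i hi k hk, hj, fun i hi => ⟨fun ha => ?_, ?_⟩⟩
  · obtain ⟨i, hi, hix⟩ := h.surj ⟨x, hx⟩
    exact ⟨i, hi, congrArg Subtype.val hix⟩
  · exact h.inj i hi j hj (Subtype.ext ((hyu _ ha.symm).trans (congrArg Subtype.val hjy).symm))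
  · rintro rfl
    rw [hjy]
    exact hy.symm

/-- The leaf receives the number `p`; `σ` turns the other new numbers into old ones, and `τ` is its
inverse. The hypotheses are pure arithmetic on numbers. -/
theorem IsLeafExtension.isLabelling {v : V} {n j : ℕ} {r r' : ℕ → ℕ → Prop} {F : ℕ → V}
    (h : IsLeafExtension X v n j r F) (p : ℕ) (hp : p ≤ n) (σ τ : ℕ → ℕ)
    (hσ : ∀ i ≤ n, i ≠ p → σ i < n ∧ τ (σ i) = i)
    (hτ : ∀ i < n, τ i ≤ n ∧ τ i ≠ p ∧ σ (τ i) = i)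
    (hr : ∀ i ≤ n, i ≠ p → ∀ k ≤ n, k ≠ p → (r' i k ↔ r (σ i) (σ k)))
    (hrp : ∀ i ≤ n, i ≠ p → ((r' i p ↔ σ i = j) ∧ (r' p i ↔ σ i = j))) (hpp : ¬ r' p p) :
    IsLabelling X (n + 1) r' fun i => if i = p then v else F (σ i) where
  inj i hi k hk hik := by
    by_cases h1 : i = p <;> by_cases h2 : k = p <;> simp only [h1, h2, if_true, if_false] at hik ⊢
    · exact absurd hik.symm (h.ne _ (hσ k (by lia) h2).1)
    · exact absurd hik (h.ne _ (hσ i (by lia) h1).1)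
    · have h3 := h.inj _ (hσ i (by lia) h1).1 _ (hσ k (by lia) h2).1 hik
      rw [← (hσ i (by lia) h1).2, h3, (hσ k (by lia) h2).2]
  surj x := by
    by_cases hx : x = v
    · exact ⟨p, by lia, by simp [hx]⟩
    · obtain ⟨i, hi, hix⟩ := h.surj x hx
      obtain ⟨h1, h2, h3⟩ := hτ i hi
      exact ⟨τ i, by lia, by simp [h2, h3, hix]⟩
  adj_iff i hi k hk := by
    by_cases h1 : i = p <;> by_cases h2 : k = p <;> simp only [h1, h2, if_true, if_false]
    · simp [hpp]
    · rw [X.adj_comm, h.adj_leaf _ (hσ k (by lia) h2).1, (hrp k (by lia) h2).2]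
    · rw [h.adj_leaf _ (hσ i (by lia) h1).1, (hrp i (by lia) h1).1]
    · rw [h.adj_iff _ (hσ i (by lia) h1).1 _ (hσ k (by lia) h2).1,
        hr i (by lia) h1 k (by lia) h2]

/-- `X` is a path, or a path with one more vertex joined to an interior vertex of the path. -/
def IsPathOrFork (X : SimpleGraph V) : Prop :=
  (∃ n f, 1 ≤ n ∧ IsLabelling X n pathRel f) ∨
    ∃ n k f, 1 ≤ k ∧ k + 3 ≤ n ∧ IsLabelling X n (forkRel n k) f

theorem IsLeafExtension.isPathOrFork_of_path {v : V} {n j : ℕ} {F : ℕ → V}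
    (h : IsLeafExtension X v n j pathRel F) : IsPathOrFork X := by
  have hj := h.lt
  by_cases h1 : j + 1 = n
  · exact Or.inl ⟨n + 1, _, by lia, h.isLabelling n le_rfl id id (by grind) (by grind) (by grind)
      (by simp only [pathRel]; grind) (by simp only [pathRel]; grind)⟩
  by_cases h0 : j = 0
  · exact Or.inl ⟨n + 1, _, by lia, h.isLabelling 0 (by lia) (fun i => i - 1) (fun i => i + 1)
      (by grind) (by grind) (by simp only [pathRel]; grind)
      (by simp only [pathRel]; grind) (by simp only [pathRel]; grind)⟩
  · exact Or.inr ⟨n + 1, j, _, by lia, by lia, h.isLabelling n le_rfl id id (by grind) (by grind)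
      (by simp only [pathRel, forkRel]; grind) (by simp only [forkRel]; grind)
      (by simp only [forkRel]; grind)⟩

variable [Fintype V]

/-- A fork with a leaf attached at an interior vertex of its path is not positive definite. -/
theorem IsLeafExtension.not_posDef_of_interior {v : V} {n k j : ℕ} {F : ℕ → V}
    (h : IsLeafExtension X v n j (forkRel n k) F) (hk : 1 ≤ k) (hkn : k + 3 ≤ n)
    (hj : 1 ≤ j) (hjn : j + 3 ≤ n) : ¬ (quadForm X).PosDef := by
  classical
  -- The path between the attachment points `j` and `k` has four outside neighbours: the path
  -- vertices `a` and `b + 1` just beyond it, the extra vertex `p = n - 1` at `k`, and the leaf `v`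
  -- at `j`.
  obtain ⟨a, ha⟩ : ∃ a, a + 1 = min j k := ⟨min j k - 1, by lia⟩
  obtain ⟨b, hb⟩ : ∃ b, b = max j k := ⟨_, rfl⟩
  have hn : ∃ p, p + 1 = n := ⟨n - 1, by lia⟩
  obtain ⟨p, hp⟩ := hn
  have hadj : ∀ x < n, ∀ y, a + 1 ≤ y → y ≤ b → forkRel n k x y →
      ∃ t ∈ (Finset.Icc (a + 1) b).image F, X.Adj (F x) t := fun x hx y hy hyb hxy =>
    ⟨F y, Finset.mem_image_of_mem F (Finset.mem_Icc.mpr ⟨hy, hyb⟩),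
      (h.adj_iff x hx y (by lia)).mpr hxy⟩
  have hnot : ∀ x < n, (x ≤ a ∨ b < x) → F x ∉ (Finset.Icc (a + 1) b).image F := by
    intro x hx hxab hmem
    obtain ⟨t, ht, htx⟩ := Finset.mem_image.mp hmem
    rw [Finset.mem_Icc] at ht
    have := h.inj t (by lia) x hx htx
    lia
  have hne : ∀ x < n, ∀ y < n, x ≠ y → F x ≠ F y := fun x hx y hy hxy hF =>
    hxy (h.inj x hx y hy hF)
  refine not_posDef_of_four_neighbours (form_sum_path_le (X := X) (F := F) (a := a + 1) (b := b)
    (by lia) ?_ ?_) ![F a, F (b + 1), F p, v] ?_ ?_ ?_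
  · intro x hx y hy hxy
    exact h.inj x (by grind) y (by grind) hxy
  · intro i hi hib
    exact (h.adj_iff i (by lia) (i + 1) (by lia)).mpr (by simp only [forkRel]; lia)
  · have h1 := hne a (by lia) (b + 1) (by lia) (by lia)
    have h2 := hne a (by lia) p (by lia) (by lia)
    have h3 := hne (b + 1) (by lia) p (by lia) (by lia)
    have h4 := h.ne a (by lia)
    have h5 := h.ne (b + 1) (by lia)
    have h6 := h.ne p (by lia)
    rw [← List.nodup_ofFn]
    simp [h1, h2, h3, h4, h5, h6]
  · intro i
    fin_cases i
    · exact hnot a (by lia) (by lia)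
    · exact hnot (b + 1) (by lia) (by lia)
    · exact hnot p (by lia) (by lia)
    · intro hmem
      obtain ⟨t, ht, htx⟩ := Finset.mem_image.mp hmem
      rw [Finset.mem_Icc] at ht
      exact h.ne t (by lia) htx
  · intro i
    fin_cases i
    · exact hadj a (by lia) (a + 1) (by lia) (by lia) (by simp only [forkRel]; lia)
    · exact hadj (b + 1) (by lia) b (by lia) (by lia) (by simp only [forkRel]; lia)
    · exact hadj p (by lia) k (by lia) (by lia) (by simp only [forkRel]; lia)
    · exact ⟨F j, Finset.mem_image_of_mem F (Finset.mem_Icc.mpr (by lia)),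
        ((h.adj_leaf j (by lia)).mpr rfl).symm⟩

/-- The extended Dynkin diagram of type `E₆` is not positive definite. -/
theorem IsLeafExtension.not_posDef_of_end {v : V} {n k j : ℕ} {F : ℕ → V}
    (h : IsLeafExtension X v n j (forkRel n k) F) (hk : 2 ≤ k) (hkn : k + 4 ≤ n)
    (hj : j + 1 = n) : ¬ (quadForm X).PosDef := by
  obtain ⟨a, rfl⟩ := Nat.exists_eq_add_of_le' hk
  have key : ∀ x y : ℕ, x < n → y < n → forkRel n (a + 2) x y → X.Adj (F x) (F y) :=
    fun x y hx hy hxy => (h.adj_iff x hx y hy).mpr hxy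
  have hne : ∀ x < n, ∀ y < n, x ≠ y → F x ≠ F y := fun x hx y hy hxy hF =>
    hxy (h.inj x hx y hy hF)
  have hv := (h.adj_leaf j h.lt).mpr rfl
  -- Five consecutive path vertices centred at the branch vertex, then the extra vertex; `v` is
  -- appended as the end of the third leg of length `2`.
  let ψ : Fin 6 → ℕ := fun i => if (i : ℕ) = 5 then j else a + i
  have hψ : ∀ i, ψ i < n := fun i => by simp only [ψ]; split_ifs <;> lia
  refine not_posDef_of_subgraph (Fin.snoc (fun i => F (ψ i)) v : Fin 7 → V) ?_
    (fun i j => ((i : ℕ) + 1 = j ∧ (j : ℕ) < 5) ∨ ((i : ℕ) = 2 ∧ (j : ℕ) = 5) ∨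
      ((i : ℕ) = 5 ∧ (j : ℕ) = 6) ∨ ((j : ℕ) + 1 = i ∧ (i : ℕ) < 5) ∨
      ((j : ℕ) = 2 ∧ (i : ℕ) = 5) ∨ ((j : ℕ) = 5 ∧ (i : ℕ) = 6)) ?_
    ![1, 2, 3, 2, 1, 2, 1] (by decide) (by decide) (by decide)
  · rw [Fin.snoc_injective_iff]
    refine ⟨fun x y hxy => ?_, ?_⟩
    · have := h.inj _ (hψ x) _ (hψ y) hxy
      simp only [ψ] at this
      grind
    · rintro ⟨i, hi⟩
      exact h.ne _ (hψ i) hi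
  · intro x y
    refine Fin.lastCases ?_ (fun x => ?_) x <;> refine Fin.lastCases ?_ (fun y => ?_) y
    · simp
    · intro hxy
      have : ψ y = j := if_pos (by simp at hxy; lia)
      rwa [Fin.snoc_last, Fin.snoc_castSucc, this, X.adj_comm]
    · intro hxy
      have : ψ x = j := if_pos (by simp at hxy; lia)
      rwa [Fin.snoc_last, Fin.snoc_castSucc, this]
    · intro hxy
      simp only [Fin.snoc_castSucc]
      refine key _ _ (hψ x) (hψ y) ?_
      simp only [Fin.val_castSucc] at hxy
      simp only [ψ, forkRel]
      grind

theorem IsLeafExtension.isPathOrFork_of_fork {v : V} {n k j : ℕ} {F : ℕ → V}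
    (h : IsLeafExtension X v n j (forkRel n k) F) (hk : 1 ≤ k) (hkn : k + 3 ≤ n)
    (hX : (quadForm X).PosDef) : IsPathOrFork X := by
  have hj := h.lt
  -- A leaf at either end of the path lengthens it. A leaf at the extra vertex gives a fork again
  -- only if another leg has length `1`, since that leg can then serve as the extra vertex.
  by_cases h1 : j + 2 = n
  · exact Or.inr ⟨n + 1, k, _, by lia, by lia, h.isLabelling (n - 1) (by lia)
      (fun i => if i = n then n - 1 else i) (fun i => if i + 1 = n then n else i)
      (by grind) (by grind) (by simp only [forkRel]; grind) (by simp only [forkRel]; grind)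
      (by simp only [forkRel]; grind)⟩
  by_cases h2 : j = 0
  · exact Or.inr ⟨n + 1, k + 1, _, by lia, by lia, h.isLabelling 0 (by lia)
      (fun i => i - 1) (fun i => i + 1)
      (by grind) (by grind) (by simp only [forkRel]; grind) (by simp only [forkRel]; grind)
      (by simp only [forkRel]; grind)⟩
  by_cases h3 : j + 1 = n
  · by_cases h4 : k = 1
    · exact Or.inr ⟨n + 1, 2, _, by lia, by lia, h.isLabelling 0 (by lia)
        (fun i => if i = 1 then n - 1 else if i = n then 0 else i - 1)
        (fun i => if i + 1 = n then 1 else if i = 0 then n else i + 1)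
        (by grind) (by grind) (by simp only [forkRel]; grind) (by simp only [forkRel]; grind)
        (by simp only [forkRel]; grind)⟩
    by_cases h5 : k + 3 = n
    · exact Or.inr ⟨n + 1, k, _, by lia, by lia, h.isLabelling (n - 1) (by lia)
        (fun i => if i + 2 = n then n - 1 else if i = n then n - 2 else i)
        (fun i => if i + 1 = n then n - 2 else if i + 2 = n then n else i)
        (by grind) (by grind) (by simp only [forkRel]; grind) (by simp only [forkRel]; grind)
        (by simp only [forkRel]; grind)⟩
    exact absurd hX (h.not_posDef_of_end (by lia) (by lia) h3)
  exact absurd hX (h.not_posDef_of_interior hk hkn (by lia) (by lia))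

/-- A connected graph with positive definite form is a path or a fork. -/
theorem isPathOrFork_of_posDef {V : Type u} [Fintype V] {X : SimpleGraph V} (hc : X.Connected)
    (hX : (quadForm X).PosDef) : IsPathOrFork X := by
  classical
  induction hn : Fintype.card V generalizing V with
  | zero =>
    have := hc.nonempty
    exact absurd hn Fintype.card_ne_zero
  | succ n ih =>
    have := hc.nonempty
    rcases subsingleton_or_nontrivial V with hV | hV
    · obtain ⟨x⟩ := this
      refine Or.inl ⟨1, fun _ => x, le_rfl, ⟨by lia, fun y => ⟨0, by lia, Subsingleton.elim _ _⟩,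
        fun i hi j hj => ?_⟩⟩
      simp only [SimpleGraph.irrefl, pathRel]
      lia
    -- A nontrivial tree has a leaf, and deleting it preserves connectedness and positive
    -- definiteness.
    · obtain ⟨v, hv⟩ := (isTree_of_posDef hX hc).exists_vert_degree_one_of_nontrivial
      have hv' := SimpleGraph.degree_eq_one_iff_existsUnique_adj.mp hv
      have hcard : Fintype.card ({v}ᶜ : Set V) = n := by
        rw [Fintype.card_compl_set]
        simp [hn]
      obtain ⟨m, f, hm, hf⟩ | ⟨m, k, f, hk, hkm, hf⟩ :=
        ih (hc.induce_compl_singleton_of_degree_eq_one hv) (posDef_induce hX _) hcard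
      · obtain ⟨j, hj⟩ := hf.isLeafExtension hv'
        exact hj.isPathOrFork_of_path
      · obtain ⟨j, hj⟩ := hf.isLeafExtension hv'
        exact hj.isPathOrFork_of_fork hk hkm hX

/-- The hypotheses on `l` and `m` say that the legs are at least as long as those of `forkGraph m
l`, which embeds by the shift `k - l` aligning the branch vertices. -/
theorem IsLabelling.not_posDef_of_forkGraph {n k m l : ℕ} {f : ℕ → V}
    (h : IsLabelling X n (forkRel n k) f) (hl : l + 1 < m) (hlk : l ≤ k) (hm : m - l ≤ n - k)
    (w : Fin m → ℤ) (hw : ∀ i, 0 < w i)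
    (hle : ∑ i : Fin m, ∑ j : Fin m, w i * w j * (if i = j then 2 else
      if forkRel m l i j then -1 else 0) ≤ 0) : ¬ (quadForm X).PosDef := by
  let ψ : Fin m → ℕ := fun i => if (i : ℕ) + 1 = m then n - 1 else k - l + i
  have hψ : ∀ i, ψ i < n := fun i => by simp only [ψ]; split_ifs <;> lia
  refine not_posDef_of_subgraph (fun i => f (ψ i)) (fun i j hij => ?_)
    (fun i j => forkRel m l i j) (fun i j hij => ?_) w hw (by lia) hle
  · have := h.inj _ (hψ i) _ (hψ j) hij
    simp only [ψ] at this
    grind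
  · refine (h.adj_iff _ (hψ i) _ (hψ j)).mpr ?_
    simp only [forkRel, ψ] at hij ⊢
    grind

theorem isADE_of_posDef {V : Type u} [Fintype V] {X : SimpleGraph V} (hc : X.Connected)
    (hX : (quadForm X).PosDef) : IsADE X := by
  have hfork : ∀ {n k : ℕ}, k + 1 < n → ∀ i j : Fin n,
      (forkGraph n k).Adj i j ↔ forkRel n k i j := fun hk i j => by
    rw [forkGraph_adj, forkRel, and_iff_right_of_imp]
    grind
  obtain ⟨n, f, hn, hf⟩ | ⟨n, k, f, hk, hkn, hf⟩ := isPathOrFork_of_posDef hc hX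
  · exact Or.inl ⟨n, hn, hf.nonempty_iso _ fun i j => SimpleGraph.pathGraph_adj⟩
  refine Or.inr ?_
  have hD : ∀ g, IsLabelling X n (forkRel n (n - 3)) g → ∃ n, 4 ≤ n ∧ Nonempty (X ≃g graphD n) :=
    fun g hg => ⟨n, by lia, hg.nonempty_iso _ fun i j => hfork (by lia) i j⟩
  have hE : ∀ g, 6 ≤ n → IsLabelling X n (forkRel n 2) g →
      ∃ n, 6 ≤ n ∧ n ≤ 8 ∧ Nonempty (X ≃g graphE n) := by
    refine fun g hn hg => ⟨n, hn, ?_, hg.nonempty_iso _ fun i j => hfork (by lia) i j⟩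
    by_contra hn'
    -- The extended diagram of type `E₈`: legs `2`, `5`, `1`, with its null vector.
    exact hg.not_posDef_of_forkGraph (m := 9) (l := 2) (by lia) (by lia) (by lia)
      ![2, 4, 6, 5, 4, 3, 2, 1, 3] (by decide) (by decide) hX
  obtain ⟨g, hg⟩ := hf.fork_reverse (by lia)
  by_cases h1 : k = 1
  · rw [show n - 2 - k = n - 3 by lia] at hg
    exact Or.inl (hD g hg)
  by_cases h2 : k + 3 = n
  · rw [show k = n - 3 by lia] at hf
    exact Or.inl (hD f hf)
  by_cases h3 : k = 2
  · rw [h3] at hf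
    exact Or.inr (hE f (by lia) hf)
  by_cases h4 : k + 4 = n
  · rw [show n - 2 - k = 2 by lia] at hg
    exact Or.inr (hE g (by lia) hg)
  -- Both legs on the path now have length at least `3`, so the extended diagram of type `E₇` (legs
  -- `3`, `3`, `1`) embeds.
  exact absurd hX (hf.not_posDef_of_forkGraph (m := 8) (l := 3) (by lia) (by lia) (by lia)
    ![1, 2, 3, 4, 3, 2, 1, 2] (by decide) (by decide))

theorem isDisjointUnionOfADE_of_posDef {V : Type u} [Fintype V] {X : SimpleGraph V}
    (hX : (quadForm X).PosDef) : IsDisjointUnionOfADE X := by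
  classical
  intro C
  have : Fintype C.supp := Subtype.fintype _
  exact isADE_of_posDef C.connected_toSimpleGraph (posDef_induce hX C.supp)

end Labels

theorem isSmall_iff_posDef {V : Type u} [Fintype V] {X : SimpleGraph V} :
    IsSmall X ↔ (quadForm X).PosDef :=
  ⟨IsSmall.posDef, fun h => (isDisjointUnionOfADE_of_posDef h).isSmall⟩

theorem isSmall_iff_isDisjointUnionOfADE {V : Type u} [Fintype V] {X : SimpleGraph V} :
    IsSmall X ↔ IsDisjointUnionOfADE X :=
  ⟨fun h => isDisjointUnionOfADE_of_posDef h.posDef, IsDisjointUnionOfADE.isSmall⟩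

theorem toReal_neg {V : Type*} (v : V → ℤ) : toReal (-v) = -toReal v := by
  ext x
  simp [toReal]

/-! ### The root system of a small graph and its base -/

section RootSystem

variable {V : Type*} [Fintype V] {X : SimpleGraph V}

theorem mem_roots_iff {v : V → ℤ} : v ∈ roots X ↔ form X v v = 2 := by
  have := two_mul_quadForm X v
  change quadForm X v = 1 ↔ _
  lia

theorem form_add_self (v w : V → ℤ) :
    form X (v + w) (v + w) = form X v v + form X w w + 2 * form X v w := by
  simp only [map_add, LinearMap.add_apply, form_comm X w v]
  ring

theorem form_sub_self (v w : V → ℤ) :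
    form X (v - w) (v - w) = form X v v + form X w w - 2 * form X v w := by
  simp only [map_sub, LinearMap.sub_apply, form_comm X w v]
  ring

theorem form_lt_two (h : (quadForm X).PosDef) {v w : V → ℤ} (hv : v ∈ roots X) (hw : w ∈ roots X)
    (hne : v ≠ w) : form X v w < 2 := by
  have := (posDef_iff_form_pos X).mp h _ (sub_ne_zero.mpr hne)
  rw [form_sub_self, mem_roots_iff.mp hv, mem_roots_iff.mp hw] at this
  lia

theorem neg_two_lt_form (h : (quadForm X).PosDef) {v w : V → ℤ} (hv : v ∈ roots X)
    (hw : w ∈ roots X) (hne : v ≠ -w) : -2 < form X v w := by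
  have := (posDef_iff_form_pos X).mp h (v + w) fun h0 => hne (eq_neg_of_add_eq_zero_left h0)
  rw [form_add_self, mem_roots_iff.mp hv, mem_roots_iff.mp hw] at this
  lia

/-- Roots are determined modulo `3`: if `v - w = 3 z` with `z ≠ 0`, its norm `9 (z|z)` is at least
`18`, whereas a difference of two roots has norm at most `8`. -/
theorem finite_roots (h : (quadForm X).PosDef) : Finite (roots X) := by
  refine Finite.of_injective (fun (v : roots X) (x : V) => ((v : V → ℤ) x : ZMod 3))
    fun v w hvw => ?_
  by_contra hne
  have hdvd : ∀ x, ∃ z : ℤ, (v : V → ℤ) x - (w : V → ℤ) x = 3 * z := fun x =>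
    ((ZMod.intCast_eq_intCast_iff_dvd_sub _ _ 3).mp (congrFun hvw x).symm)
  choose z hz using hdvd
  have hz' : (v : V → ℤ) - w = (3 : ℤ) • z := funext fun x => by simpa using hz x
  have hne' : (v : V → ℤ) ≠ w := fun h => hne (Subtype.ext h)
  have hz0 : z ≠ 0 := by
    rintro rfl
    exact hne' (sub_eq_zero.mp (by simpa using hz'))
  have h1 := (posDef_iff_form_pos X).mp h z hz0
  have h2 := form_sub_self (X := X) (v : V → ℤ) w
  have h3 := two_mul_quadForm X z
  rw [hz', form_self_of_mem, form_self_of_mem] at h2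
  simp only [map_smul, LinearMap.smul_apply, smul_eq_mul] at h2
  by_cases hneg : (v : V → ℤ) = -w
  · have : form X (v : V → ℤ) w = -2 := by
      rw [hneg, map_neg, LinearMap.neg_apply, form_self_of_mem]
    lia
  · have := neg_two_lt_form h v.2 w.2 hneg
    lia

/-- A vertex, seen as a root. -/
def simpleRoot (X : SimpleGraph V) (x : V) : roots X :=
  ⟨basisVec x, mem_roots_iff.mpr (by simp)⟩

theorem simpleRoot_injective (X : SimpleGraph V) : Function.Injective (simpleRoot X) := by
  intro x y h
  by_contra hne
  have := congrFun (congrArg Subtype.val h) x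
  simp [simpleRoot, basisVec_ne hne] at this

variable (hX : IsSmall X)

theorem rootSystem_root (v : roots X) : (rootSystem X hX).root v = toReal (v : V → ℤ) := rfl

theorem rootSystem_pairing (v w : roots X) :
    (rootSystem X hX).pairing v w = (form X (v : V → ℤ) w : ℤ) := by
  rw [form_comm, ← realForm_toReal]
  rfl

theorem eq_sum_smul_root (f : V → ℝ) :
    f = ∑ x, f x • (rootSystem X hX).root (simpleRoot X x) := by
  classical
  ext y
  simp [rootSystem_root, simpleRoot, toReal, basisVec, Finset.sum_apply, Pi.single_apply]

theorem isSimplyLacedRootSystem_rootSystem : IsSimplyLacedRootSystem (rootSystem X hX) := by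
  have hfin := finite_roots hX.posDef
  have hcrys : (rootSystem X hX).IsCrystallographic :=
    ⟨fun v w => ⟨form X (v : V → ℤ) w, by rw [rootSystem_pairing]; rfl⟩⟩
  have hspan : (rootSystem X hX).rootSpan ℝ = ⊤ := by
    refine eq_top_iff.mpr fun f _ => ?_
    rw [eq_sum_smul_root hX f]
    exact Submodule.sum_mem _ fun x _ => Submodule.smul_mem _ _ (Submodule.subset_span ⟨_, rfl⟩)
  have := Fintype.ofFinite (roots X)
  refine ⟨hfin, ⟨hspan, (RootPairing.rootSpan_eq_top_iff _).mp hspan⟩, hcrys, ⟨fun v w h => ?_⟩,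
    fun v w h1 h2 => ?_⟩
  · by_contra hne
    rw [not_or] at hne
    apply h
    have h1 := form_lt_two hX.posDef v.2 w.2 fun h => hne.1 (by simp [rootSystem_root, h])
    have h2 := neg_two_lt_form hX.posDef v.2 w.2 fun h => hne.2 (by
      simp only [rootSystem_root, h, toReal_neg])
    rw [LinearIndependent.pair_iff]
    intro s t hst
    -- Pairing the relation with both roots gives a system with matrix `(2, c; c, 2)`, invertible
    -- for `|c| ≤ 1`.
    have hv := congrArg (fun f => realForm X (toReal (v : V → ℤ)) f) hst
    have hw := congrArg (fun f => realForm X (toReal (w : V → ℤ)) f) hst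
    simp only [rootSystem_root, map_add, map_smul, realForm_toReal, form_self_of_mem, map_zero,
      smul_eq_mul, form_comm X (w : V → ℤ) v] at hv hw
    set c := form X (v : V → ℤ) w
    have hc : c = -1 ∨ c = 0 ∨ c = 1 := by lia
    obtain hc | hc | hc := hc <;> rw [hc] at hv hw <;> push_cast at hv hw <;>
      constructor <;> linarith
  · have h1 := form_lt_two hX.posDef v.2 w.2 fun h => h1 (by simp [rootSystem_root, h])
    have h2 := neg_two_lt_form hX.posDef v.2 w.2 fun h => h2 (by
      simp only [rootSystem_root, h, toReal_neg])
    rw [rootSystem_pairing]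
    set c := form X (v : V → ℤ) w
    have hc : c = -1 ∨ c = 0 ∨ c = 1 := by lia
    obtain hc | hc | hc := hc <;> simp [hc]

/-- The coordinates of a root are all nonnegative or all nonpositive. -/
theorem nonneg_or_nonpos_of_mem_roots (h : (quadForm X).PosDef) {v : V → ℤ} (hv : v ∈ roots X) :
    0 ≤ v ∨ 0 ≤ -v := by
  -- The positive and negative parts have disjoint supports, so only off-diagonal Gram entries
  -- contribute. If both parts were nonzero, each would have norm at least `2`, and `v` norm at
  -- least `4`.
  have hle : form X (v ⊔ 0) (-v ⊔ 0) ≤ 0 := by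
    rw [form_apply]
    refine Finset.sum_nonpos fun x _ => Finset.sum_nonpos fun y _ => ?_
    have hx : 0 ≤ (v ⊔ 0) x := le_sup_right
    have hy : 0 ≤ (-v ⊔ 0) y := le_sup_right
    rcases eq_or_ne x y with rfl | hxy
    · have : (v ⊔ 0) x = 0 ∨ (-v ⊔ 0) x = 0 := by
        simp only [Pi.sup_apply, Pi.neg_apply, Pi.zero_apply]
        lia
      obtain h | h := this <;> simp [h]
    · exact mul_nonpos_of_nonpos_of_nonneg
        (mul_nonpos_of_nonneg_of_nonpos hx (gram_nonpos X hxy)) hy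
  have hsub : v = (v ⊔ 0) - (-v ⊔ 0) := by
    ext x
    simp only [Pi.sup_apply, Pi.sub_apply, Pi.neg_apply, Pi.zero_apply]
    lia
  have h2 := mem_roots_iff.mp hv
  rw [hsub, form_sub_self] at h2
  have hp := two_mul_quadForm X (v ⊔ 0)
  have hn := two_mul_quadForm X (-v ⊔ 0)
  by_cases h0 : v ⊔ 0 = 0
  · right
    rw [hsub, h0]
    intro x
    simp
  by_cases h1 : -v ⊔ 0 = 0
  · left
    rw [hsub, h1]
    intro x
    simp
  have := h _ h0
  have := h _ h1
  lia

theorem toReal_mem_closure {v : V → ℤ} (hv : 0 ≤ v) :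
    toReal v ∈ AddSubmonoid.closure
      ((rootSystem X hX).root '' Set.range (simpleRoot X)) := by
  rw [eq_sum_smul_root hX (toReal v)]
  refine AddSubmonoid.sum_mem _ fun x _ => ?_
  have : toReal v x = ((v x).toNat : ℝ) := by
    have : ((v x).toNat : ℤ) = v x := Int.toNat_of_nonneg (hv x)
    simp only [toReal]
    exact_mod_cast this.symm
  rw [this, Nat.cast_smul_eq_nsmul]
  exact AddSubmonoid.nsmul_mem _ (AddSubmonoid.subset_closure
    (Set.mem_image_of_mem _ (Set.mem_range_self x))) _

theorem linearIndepOn_simpleRoot :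
    LinearIndepOn ℝ (rootSystem X hX).root (Set.range (simpleRoot X)) := by
  classical
  have h : LinearIndependent ℝ ((rootSystem X hX).root ∘ simpleRoot X) := by
    convert (Pi.basisFun ℝ V).linearIndependent using 2 with x
    ext y
    simp [rootSystem_root, simpleRoot, toReal, basisVec, Pi.single_apply]
  exact (linearIndepOn_range_iff (simpleRoot_injective X) _).mpr h

theorem exists_base : ∃ b : (rootSystem X hX).Base, (b.support : Set (roots X)) =
    Set.range (simpleRoot X) := by
  have h := isSimplyLacedRootSystem_rootSystem hX
  have := h.finite
  have := h.isRootSystem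
  have := h.isCrystallographic
  have := h.isReduced
  refine ⟨RootPairing.Base.mk' _ (Set.range (simpleRoot X)) (linearIndepOn_simpleRoot hX)
    fun v => ?_, by simp [RootPairing.Base.mk']⟩
  rcases nonneg_or_nonpos_of_mem_roots hX.posDef v.2 with hv | hv
  · exact Or.inl (toReal_mem_closure hX hv)
  · right
    rw [rootSystem_root, ← toReal_neg]
    exact toReal_mem_closure hX hv

end RootSystem

/-! ### Equivalences of root systems and bases -/

section Bases

variable {ι ι₂ R M N M₂ N₂ : Type*} [CommRing R] [AddCommGroup M] [Module R M] [AddCommGroup N]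
  [Module R N] [AddCommGroup M₂] [Module R M₂] [AddCommGroup N₂] [Module R N₂]
  {P : RootPairing ι R M N} {Q : RootPairing ι₂ R M₂ N₂}

theorem root_indexEquiv (e : RootPairing.Equiv P Q) (i : ι) :
    Q.root (e.indexEquiv i) = e.weightMap (P.root i) :=
  (RootPairing.Hom.root_weightMap_apply P Q i e.toHom).symm

theorem pairing_indexEquiv (e : RootPairing.Equiv P Q) (i j : ι) :
    Q.pairing (e.indexEquiv i) (e.indexEquiv j) = P.pairing i j := by
  have h := RootPairing.Hom.weight_coweight_transpose_apply P Q (Q.coroot (e.indexEquiv j)) e.toHom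
  have h' := LinearMap.congr_fun h (P.root i)
  rw [RootPairing.Hom.coroot_coweightMap_apply, Equiv.symm_apply_apply] at h'
  rw [← Q.root_coroot_eq_pairing, ← P.root_coroot_eq_pairing, root_indexEquiv]
  exact h'

theorem indexEquiv_reflectionPerm_self (e : RootPairing.Equiv P Q) (i : ι) :
    e.indexEquiv (P.reflectionPerm i i) =
      Q.reflectionPerm (e.indexEquiv i) (e.indexEquiv i) := by
  apply Q.root.injective
  rw [root_indexEquiv, P.root_reflectionPerm, P.reflection_apply_self, map_neg,
    Q.root_reflectionPerm, Q.reflection_apply_self, root_indexEquiv]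

theorem root_indexEquiv_eq_add (e : RootPairing.Equiv P Q) {i j k : ι} :
    Q.root (e.indexEquiv i) = Q.root (e.indexEquiv j) + Q.root (e.indexEquiv k) ↔
      P.root i = P.root j + P.root k := by
  simp only [root_indexEquiv, ← map_add]
  exact e.bijective_weightMap.1.eq_iff

variable [CharZero R] [IsDomain R] [Finite ι] [Finite ι₂] [P.IsCrystallographic]
  [Q.IsCrystallographic]

omit [IsDomain R] [Finite ι] [P.IsCrystallographic] in
theorem isPos_reflectionPerm_self_iff (b : P.Base) (i : ι) :
    b.IsPos (P.reflectionPerm i i) ↔ ¬ b.IsPos i :=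
  RootPairing.Base.IsPos.neg_iff_not b i

/-- Simple roots are the indecomposable positive ones, so an equivalence matching positive roots
matches bases. Heights are additive and equal `1` on simple roots; conversely, a positive non-simple
root pairs positively with some simple root, which can be subtracted. -/
theorem mem_support_iff (b : P.Base) (i : ι) : i ∈ b.support ↔
    b.IsPos i ∧ ∀ j k, b.IsPos j → b.IsPos k → P.root i ≠ P.root j + P.root k := by
  refine ⟨fun hi => ⟨RootPairing.Base.isPos_of_mem_support hi, fun j k hj hk h => ?_⟩,
    fun ⟨hi, h⟩ => ?_⟩
  · have := b.height_add h
    rw [RootPairing.Base.height_one_of_mem_support hi] at this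
    rw [RootPairing.Base.isPos_iff] at hj hk
    lia
  · by_contra hn
    obtain ⟨j, hj, hij⟩ := hi.exists_mem_support_pos_pairingIn
    rw [P.zero_lt_pairingIn_iff'] at hij
    obtain ⟨k, hk⟩ := P.root_sub_root_mem_of_pairingIn_pos hij (by rintro rfl; exact hn hj)
    exact h k j (hi.sub hj hk) (RootPairing.Base.isPos_of_mem_support hj) (by rw [hk]; abel)

/-- Any equivalence of root systems can be modified so as to map a given base to another. -/
theorem exists_equiv_map_support [P.IsReduced] (b : P.Base) (b₂ : Q.Base)
    (e₀ : RootPairing.Equiv P Q) :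
    ∃ e : RootPairing.Equiv P Q, ∀ i, e.indexEquiv i ∈ b₂.support ↔ i ∈ b.support := by
  classical
  have := Fintype.ofFinite ι
  -- The positive roots sent to negative ones; an equivalence with the fewest of them has none.
  let S : RootPairing.Equiv P Q → Finset ι := fun e =>
    Finset.univ.filter fun i => b.IsPos i ∧ ¬ b₂.IsPos (e.indexEquiv i)
  have hS : ∀ e i, i ∈ S e ↔ b.IsPos i ∧ ¬ b₂.IsPos (e.indexEquiv i) := fun e i => by simp [S]
  obtain ⟨e, he⟩ : ∃ e, ∀ e', (S e).card ≤ (S e').card := by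
    have : Nonempty (RootPairing.Equiv P Q) := ⟨e₀⟩
    exact ⟨Function.argmin fun e => (S e).card,
      fun e' => Function.argmin_le (fun e => (S e).card) e'⟩
  have hsimple : ∀ j ∈ b.support, b₂.IsPos (e.indexEquiv j) := by
    intro j hj
    by_contra hneg
    have hjpos := RootPairing.Base.isPos_of_mem_support hj
    let e' : RootPairing.Equiv P Q := e.comp (RootPairing.Equiv.reflection P j)
    have he' : ∀ i, e'.indexEquiv i = e.indexEquiv (P.reflectionPerm j i) := fun i => rfl
    -- The reflection in a simple root `j` permutes the positive roots other than `j`, so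
    -- precomposing with it removes `j` from the bad set and adds nothing.
    have hlt : ((S e').image (P.reflectionPerm j)).card < (S e).card := by
      refine Finset.card_lt_card (Finset.ssubset_iff_of_subset ?_ |>.mpr ⟨j, ?_, ?_⟩)
      · intro k hk
        obtain ⟨i, hi, rfl⟩ := Finset.mem_image.mp hk
        rw [hS, he'] at hi
        refine (hS _ _).mpr ⟨hi.1.reflectionPerm hj ?_, hi.2⟩
        rintro rfl
        rw [indexEquiv_reflectionPerm_self, isPos_reflectionPerm_self_iff] at hi
        exact hi.2 hneg
      · exact (hS _ _).mpr ⟨hjpos, hneg⟩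
      · intro hk
        obtain ⟨i, hi, hij⟩ := Finset.mem_image.mp hk
        rw [hS, ← P.reflectionPerm_self j i, hij, isPos_reflectionPerm_self_iff] at hi
        exact hi.1 hjpos
    rw [Finset.card_image_of_injective _ (P.reflectionPerm j).injective] at hlt
    exact absurd (he e') (by lia)
  have hpos : ∀ i, b.IsPos i → b₂.IsPos (e.indexEquiv i) := fun i hi =>
    hi.induction_on_add (p := fun i => b₂.IsPos (e.indexEquiv i)) hsimple fun i j k hk hi hj =>
      hi.add (hsimple j hj) ((root_indexEquiv_eq_add e).mpr hk)
  have hpos' : ∀ i, b₂.IsPos (e.indexEquiv i) ↔ b.IsPos i := fun i => by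
    refine ⟨fun h => ?_, hpos i⟩
    by_contra hn
    have := hpos _ ((isPos_reflectionPerm_self_iff b i).mpr hn)
    rw [indexEquiv_reflectionPerm_self, isPos_reflectionPerm_self_iff] at this
    exact this h
  refine ⟨e, fun i => ?_⟩
  rw [mem_support_iff, mem_support_iff, hpos']
  refine and_congr_right fun _ => ?_
  rw [← e.indexEquiv.forall_congr_right]
  refine forall_congr' fun j => ?_
  rw [← e.indexEquiv.forall_congr_right]
  refine forall_congr' fun k => ?_
  rw [hpos', hpos', Ne, Ne, root_indexEquiv_eq_add]

theorem nonempty_equiv_of_pairing_eq [P.IsRootSystem] [Q.IsRootSystem] [P.IsReduced] [Q.IsReduced]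
    {V W : Type*} (b : P.Base) (b₂ : Q.Base) (s : V → ι) (t : W → ι₂)
    (hs : Function.Injective s) (ht : Function.Injective t)
    (hb : (b.support : Set ι) = Set.range s) (hb₂ : (b₂.support : Set ι₂) = Set.range t)
    (e : V ≃ W) (he : ∀ x y, Q.pairing (t (e x)) (t (e y)) = P.pairing (s x) (s y)) :
    Nonempty (RootPairing.Equiv P Q) := by
  let f : V ≃ b.support := (Equiv.ofInjective s hs).trans (Equiv.setCongr hb.symm)
  let g : W ≃ b₂.support := (Equiv.ofInjective t ht).trans (Equiv.setCongr hb₂.symm)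
  refine ⟨RootPairing.Base.equivOfCartanMatrixEq b b₂ ((f.symm.trans e).trans g) ?_⟩
  intro i j
  obtain ⟨x, rfl⟩ := f.surjective i
  obtain ⟨y, rfl⟩ := f.surjective j
  apply FaithfulSMul.algebraMap_injective ℤ R
  rw [RootPairing.Base.algebraMap_cartanMatrixIn_apply,
    RootPairing.Base.algebraMap_cartanMatrixIn_apply]
  have h : ∀ x, ((f.symm.trans e).trans g) (f x) = g (e x) := fun x =>
    congrArg (fun z => g (e z)) (f.symm_apply_apply x)
  rw [h, h]
  exact he x y

end Bases

/-! ### Small graphs and simply-laced root systems -/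

section Classification

variable {V W : Type*} [Fintype V] [Fintype W] {X : SimpleGraph V} {Y : SimpleGraph W}

theorem nonempty_iso_iff_nonempty_equiv (hX : IsSmall X) (hY : IsSmall Y) :
    Nonempty (X ≃g Y) ↔ Nonempty (RootPairing.Equiv (rootSystem X hX) (rootSystem Y hY)) := by
  have hP := isSimplyLacedRootSystem_rootSystem hX
  have hQ := isSimplyLacedRootSystem_rootSystem hY
  have := hP.finite
  have := hP.isRootSystem
  have := hP.isCrystallographic
  have := hP.isReduced
  have := hQ.finite
  have := hQ.isRootSystem
  have := hQ.isCrystallographic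
  have := hQ.isReduced
  obtain ⟨b, hb⟩ := exists_base hX
  obtain ⟨b₂, hb₂⟩ := exists_base hY
  constructor
  · rintro ⟨e⟩
    refine nonempty_equiv_of_pairing_eq b b₂ (simpleRoot X) (simpleRoot Y)
      (simpleRoot_injective X) (simpleRoot_injective Y) hb hb₂ e.toEquiv fun x y => ?_
    have : gram Y (e x) (e y) = gram X x y := by
      rcases eq_or_ne x y with rfl | hxy
      · simp
      · by_cases h : X.Adj x y
        · rw [gram_of_adj h, gram_of_adj (e.map_adj_iff.mpr h)]
        · rw [gram_of_not_adj hxy h, gram_of_not_adj (e.injective.ne hxy) (mt e.map_adj_iff.mp h)]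
    simp [rootSystem_pairing, simpleRoot, this]
  · rintro ⟨e₀⟩
    obtain ⟨e, he⟩ := exists_equiv_map_support b b₂ e₀
    have hmem : ∀ i, e.indexEquiv i ∈ Set.range (simpleRoot Y) ↔ i ∈ Set.range (simpleRoot X) := by
      intro i
      rw [← hb, ← hb₂]
      exact he i
    have hφ : ∀ x, ∃ y, simpleRoot Y y = e.indexEquiv (simpleRoot X x) := fun x =>
      (hmem _).mpr ⟨x, rfl⟩
    choose φ hφ using hφ
    have hinj : Function.Injective φ := fun x y hxy => simpleRoot_injective X <|
      e.indexEquiv.injective (by rw [← hφ, ← hφ, hxy])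
    have hsurj : Function.Surjective φ := fun y => by
      obtain ⟨x, hx⟩ := (hmem (e.indexEquiv.symm (simpleRoot Y y))).mp ⟨y, by simp⟩
      exact ⟨x, simpleRoot_injective Y (by rw [hφ, hx, Equiv.apply_symm_apply])⟩
    refine ⟨⟨Equiv.ofBijective φ ⟨hinj, hsurj⟩, fun {x y} => ?_⟩⟩
    have h := pairing_indexEquiv e (simpleRoot X x) (simpleRoot X y)
    rw [← hφ, ← hφ, rootSystem_pairing, rootSystem_pairing, Int.cast_inj] at h
    simp only [simpleRoot, form_basisVec] at h
    change Y.Adj (φ x) (φ y) ↔ _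
    rw [← gram_eq_neg_one_iff, h, gram_eq_neg_one_iff]

/-- Off-diagonal Cartan integers of a base are nonpositive, hence `0` or `-1` here, so the Cartan
matrix is the Gram matrix of a graph. -/
theorem exists_graph_of_isSimplyLacedRootSystem {ι M N : Type*} [AddCommGroup M] [Module ℝ M]
    [AddCommGroup N] [Module ℝ N] (P : RootPairing ι ℝ M N) (hP : IsSimplyLacedRootSystem P) :
    ∃ (n : ℕ) (X : SimpleGraph (Fin n)) (hX : IsSmall X),
      Nonempty (RootPairing.Equiv P (rootSystem X hX)) := by
  have := hP.finite
  have := Fintype.ofFinite ι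
  have := hP.isRootSystem
  have := hP.isCrystallographic
  have := hP.isReduced
  have : Module.IsReflexive ℝ M := .of_isPerfPair P.toLinearMap
  obtain ⟨b⟩ := P.nonempty_base
  let s : Fin b.support.card → ι := fun i => b.support.equivFin.symm i
  have hs : Function.Injective s := Subtype.val_injective.comp (Equiv.injective _)
  have hb : (b.support : Set ι) = Set.range s := by
    ext i
    exact ⟨fun hi => ⟨b.support.equivFin ⟨i, hi⟩, by simp [s]⟩,
      by rintro ⟨j, rfl⟩; exact (b.support.equivFin.symm j).2⟩
  have hmem : ∀ i, s i ∈ b.support := fun i => (b.support.equivFin.symm i).2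
  let X : SimpleGraph (Fin b.support.card) :=
    { Adj := fun i j => i ≠ j ∧ P.pairing (s i) (s j) ≠ 0
      symm := ⟨fun i j h => ⟨h.1.symm, mt P.pairing_eq_zero_iff.mp h.2⟩⟩
      loopless := ⟨fun i h => h.1 rfl⟩ }
  have hgram : ∀ i j, (gram X i j : ℝ) = P.pairing (s i) (s j) := by
    intro i j
    rcases eq_or_ne i j with rfl | hij
    · simp
    have hne : s i ≠ s j := hs.ne hij
    by_cases h : P.pairing (s i) (s j) = 0
    · rw [gram_of_not_adj (X := X) hij fun ha => ha.2 h, h, Int.cast_zero]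
    · rw [gram_of_adj (X := X) ⟨hij, h⟩]
      have h1 := hP.pairing_mem (s i) (s j) (fun h => hne (P.root.injective h))
        (b.root_ne_neg_of_ne (hmem i) (hmem j) hne)
      have h2 : P.pairing (s i) (s j) ≤ 0 := by
        have := b.pairingIn_le_zero_of_ne hne (hmem i) (hmem j)
        rw [← P.algebraMap_pairingIn ℤ, eq_intCast]
        exact_mod_cast this
      obtain h1 | h1 | h1 := h1
      · exact absurd h1 h
      · linarith
      · simp [h1]
  let d : Fin b.support.card → ℝ := fun i => P.RootForm (P.root (s i)) (P.root (s i))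
  have hd : ∀ i, 0 < d i := fun i =>
    P.rootForm_pos_of_ne_zero (Submodule.subset_span ⟨_, rfl⟩) (P.ne_zero _)
  have hB : ∀ i j, 2 * P.RootForm (P.root (s i)) (P.root (s j)) = P.pairing (s i) (s j) * d j :=
    fun i j => P.toInvariantForm.two_mul_apply_root_root (s i) (s j)
  have hsymm : ∀ i j, P.RootForm (P.root (s i)) (P.root (s j)) =
      P.RootForm (P.root (s j)) (P.root (s i)) := fun i j => P.rootForm_symmetric.eq _ _
  -- The simple roots need not all have the same length for `RootForm`. Symmetry of the form and of
  -- the Gram matrix forces equal lengths on adjacent vertices; otherwise both sides vanish.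
  have hBd : ∀ i j, 2 * P.RootForm (P.root (s i)) (P.root (s j)) =
      gram X i j * (√(d i) * √(d j)) := by
    intro i j
    have h1 := hB i j
    have h2 := hB j i
    rw [← hgram] at h1 h2
    rw [h1]
    by_cases h0 : gram X i j = 0
    · simp [h0]
    · have h0' : (gram X i j : ℝ) ≠ 0 := by exact_mod_cast h0
      have : d i = d j := by
        rw [hsymm j i, gram_symm X j i, h1] at h2
        exact (mul_left_cancel₀ h0' h2).symm
      rw [this, Real.mul_self_sqrt (hd j).le]
  have hX : IsSmall X := by
    rw [isSmall_iff_posDef, posDef_iff_form_pos]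
    intro v hv
    -- Dividing the simple roots by their lengths turns `2 * RootForm` into the form of the graph,
    -- which thus inherits positivity.
    set α : M := ∑ i, (v i / √(d i)) • P.root (s i) with hα
    have hsqrt : ∀ i, √(d i) ≠ 0 := fun i => (Real.sqrt_pos.mpr (hd i)).ne'
    have hα0 : α ≠ 0 := by
      intro h0
      have hli : LinearIndependent ℝ (P.root ∘ s) :=
        (linearIndepOn_range_iff hs _).mp (hb ▸ b.linearIndepOn_root)
      apply hv
      ext i
      have := Fintype.linearIndependent_iff.mp hli _ h0 i
      simpa [hsqrt i] using this
    have hpos : 0 < P.RootForm α α := P.rootForm_pos_of_ne_zero (by simp) hα0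
    have : (form X v v : ℝ) = 2 * P.RootForm α α := by
      rw [form_apply, hα]
      push_cast
      simp only [map_sum, LinearMap.sum_apply, map_smul, LinearMap.smul_apply, smul_eq_mul,
        Finset.mul_sum]
      rw [Finset.sum_comm]
      refine Finset.sum_congr rfl fun i _ => Finset.sum_congr rfl fun j _ => ?_
      have := hBd j i
      have h1 := hsqrt i
      have h2 := hsqrt j
      field_simp
      linear_combination (-(v i * v j : ℝ)) * this
    exact_mod_cast this ▸ (by positivity : 0 < 2 * P.RootForm α α)
  have hQ := isSimplyLacedRootSystem_rootSystem hX
  have := hQ.finite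
  have := hQ.isRootSystem
  have := hQ.isCrystallographic
  have := hQ.isReduced
  obtain ⟨b₂, hb₂⟩ := exists_base hX
  refine ⟨_, X, hX, nonempty_equiv_of_pairing_eq b b₂ s (simpleRoot X) hs (simpleRoot_injective X)
    hb hb₂ (Equiv.refl _) fun i j => ?_⟩
  rw [rootSystem_pairing, ← hgram]
  simp [simpleRoot]

end Classification

end SmallGraph

end

theorem mainTheorem6 :
    -- the small graphs are exactly the disjoint unions of ADE graphs
    (∀ (V : Type u) [Fintype V] (X : SimpleGraph V),
      SmallGraph.IsSmall X ↔ SmallGraph.IsDisjointUnionOfADE X) ∧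
    -- a graph is small exactly when its lattice is positive definite
    (∀ (V : Type u) [Fintype V] (X : SimpleGraph V),
      SmallGraph.IsSmall X ↔ (SmallGraph.quadForm X).PosDef) ∧
    -- the norm `1` vectors of the lattice of a small graph form a simply-laced root system
    (∀ (V : Type u) [Fintype V] (X : SimpleGraph V) (hX : SmallGraph.IsSmall X),
      SmallGraph.IsSimplyLacedRootSystem (SmallGraph.rootSystem X hX) ∧
      Set.range (SmallGraph.rootSystem X hX).root =
        SmallGraph.toReal '' {v : V → ℤ | SmallGraph.quadForm X v = 1}) ∧
    -- small graphs are isomorphic exactly when their root systems are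
    (∀ (V : Type u) [Fintype V] (V' : Type v) [Fintype V'] (X : SimpleGraph V)
        (X' : SimpleGraph V') (hX : SmallGraph.IsSmall X) (hX' : SmallGraph.IsSmall X'),
      Nonempty (X ≃g X') ↔
        Nonempty (RootPairing.Equiv (SmallGraph.rootSystem X hX)
          (SmallGraph.rootSystem X' hX'))) ∧
    -- every simply-laced root system is isomorphic to that of a small graph
    (∀ (ι : Type u) (M : Type v) (N : Type w) [AddCommGroup M] [Module ℝ M]
        [AddCommGroup N] [Module ℝ N] (P : RootPairing ι ℝ M N),
      SmallGraph.IsSimplyLacedRootSystem P →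
        ∃ (n : ℕ) (X : SimpleGraph (Fin n)) (hX : SmallGraph.IsSmall X),
          Nonempty (RootPairing.Equiv P (SmallGraph.rootSystem X hX))) := by
  refine ⟨fun V _ X => SmallGraph.isSmall_iff_isDisjointUnionOfADE,
    fun V _ X => SmallGraph.isSmall_iff_posDef,
    fun V _ X hX => ⟨SmallGraph.isSimplyLacedRootSystem_rootSystem hX, ?_⟩,
    fun V _ V' _ X X' hX hX' => SmallGraph.nonempty_iso_iff_nonempty_equiv hX hX',
    fun ι M N _ _ _ _ P hP => SmallGraph.exists_graph_of_isSimplyLacedRootSystem P hP⟩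
  ext f
  constructor
  · rintro ⟨v, rfl⟩
    exact ⟨v, v.2, rfl⟩
  · rintro ⟨v, hv, rfl⟩
    exact ⟨⟨v, hv⟩, rfl⟩
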